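/- Let $\mathbf T^2=\mathbf R^2/(2\pi\mathbf Z)^2$ and let $M,N$ be integers with $2\le M\le N$. Let $p(\xi)$ be a polynomial in $\xi=(\xi_1,\xi_2)$ with real coefficients and $q(\xi,\epsilon)$ a polynomial in $(\xi,\epsilon)$ with complex coefficients, such that $d_\xi p(0)$ and $\mathrm{Re}\,d_\xi q(0,0)$ are linearly independent. Let $\kappa>0$, and let $r(x,\xi,\epsilon)$ be, for each $\epsilon\in(0,\kappa)$, holomorphic in $(x,\xi)$ and $(2\pi\mathbf Z)^2$-periodic in $x$ in the complex domain $|\mathrm{Im}\,x_j|<\kappa$, $|\xi|<\kappa$, with $r=\mathcal O(\epsilon^M+|\xi|^N)$ uniformly there. Put $$p(x,\xi,\epsilon)=p(\xi)+i\epsilon q(\xi,\epsilon)+r(x,\xi,\epsilon).$$ Call a smooth function on $\mathbf R^2$ grad-periodic if its gradient is $(2\pi\mathbf Z)^2$-periodic. For $\xi$ and $\epsilon$ small, let $y_1,y_2$ be the (complex-valued) linear functions of $x\in\mathbf R^2$ with $l_j\cdot\partial_x y_k=\delta_{jk}$, where $l_1=p'_\xi(\xi)$, $l_2=q'_\xi(\xi,\epsilon)$,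 and put $w^*=\frac12\left(\epsilon y_1+\frac1i y_2\right)$. **Proposition 4.1.** For every $C_0>0$ there are $\epsilon_0>0$, $\delta>0$ and constants $C_s$ ($s>1$) such that for all $\epsilon,\widetilde\epsilon\in(0,\epsilon_0)$ with $$\frac{\epsilon^M+\widetilde\epsilon^N}{\epsilon\min(\epsilon,\widetilde\epsilon)}\le\delta$$ and all $\xi\in\mathbf R^2$ with $|\xi|\le C_0\widetilde\epsilon$, the following holds. The functions $y_1,y_2$ exist, and the Hamilton–Jacobi equation $$p(x,\varphi'_x(x),\epsilon)=p(\xi)+i\epsilon q(\xi,\epsilon),\qquad x\in\mathbf R^2,$$ has a solution $\varphi(x)=x\cdot\xi+\widetilde\epsilon\rho(x)$, with $|\varphi'_x(x)|<\kappa$ for all $x$, where $\rho$ is grad-periodic of the form $\rho=\rho_{\rm per}+b\,w^*$ with $\rho_{\rm per}$ smooth and $(2\pi\mathbf Z)^2$-periodic and $b\in\mathbf C$. Moreover $$\|\rho'_x\|_{H^s(\mathbf T^2)}\le C_s\,\frac{\epsilon^M+\widetilde\epsilon^N}{\epsilon\widetilde\epsilon}\qquad\text{for all } s>1.$$ -/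

import Mathlib

open Complex MeasureTheory
open scoped ENNReal ContDiff

namespace HamiltonJacobi

noncomputable section

/-- The normal form part `p(ζ) + i ε q(ζ, ε)` of the symbol. Here `p` is a polynomial in
`ζ = (ζ₁, ζ₂)` with real coefficients and `q` is a polynomial in `(ζ₁, ζ₂, ε)` with complex
coefficients; `ζ` may be complex. -/
def normalForm (p : MvPolynomial (Fin 2) ℝ) (q : MvPolynomial (Fin 3) ℂ)
    (ζ : Fin 2 → ℂ) (ε : ℝ) : ℂ :=
  MvPolynomial.aeval ζ p + I * (ε : ℂ) * MvPolynomial.eval ![ζ 0, ζ 1, (ε : ℂ)] q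

/-- The full symbol `p(x, ζ, ε) = p(ζ) + i ε q(ζ, ε) + r(x, ζ, ε)`. -/
def symbol (p : MvPolynomial (Fin 2) ℝ) (q : MvPolynomial (Fin 3) ℂ)
    (r : (Fin 2 → ℂ) → (Fin 2 → ℂ) → ℝ → ℂ) (x ζ : Fin 2 → ℂ) (ε : ℝ) : ℂ :=
  normalForm p q ζ ε + r x ζ ε

/-- The gradient `p'_ξ(ζ)`. -/
def gradP (p : MvPolynomial (Fin 2) ℝ) (ζ : Fin 2 → ℂ) : Fin 2 → ℂ :=
  fun i => MvPolynomial.aeval ζ (MvPolynomial.pderiv i p)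

/-- The gradient `q'_ξ(ζ, ε)`, with respect to the first two variables. -/
def gradQ (q : MvPolynomial (Fin 3) ℂ) (ζ : Fin 2 → ℂ) (ε : ℝ) : Fin 2 → ℂ :=
  fun i => MvPolynomial.eval ![ζ 0, ζ 1, (ε : ℂ)] (MvPolynomial.pderiv i.castSucc q)

/-- The complex neighbourhood `|Im x_j| < κ`, `|ζ| < κ` of the zero section of `T^*𝕋²`, lifted
to the universal cover in `x`. -/
def complexNhd (κ : ℝ) : Set ((Fin 2 → ℂ) × (Fin 2 → ℂ)) :=
  {z | (∀ i, |(z.1 i).im| < κ) ∧ ‖z.2‖ < κ}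

/-- `r` is a holomorphic function of `(x, ζ)` in a fixed complex neighbourhood of the zero section
of `T^*𝕋²`, and is `O(ε^M + |ζ|^N)` there. -/
structure IsRemainder (κ K : ℝ) (M N : ℕ)
    (r : (Fin 2 → ℂ) → (Fin 2 → ℂ) → ℝ → ℂ) : Prop where
  holomorphic : ∀ ε ∈ Set.Ioo 0 κ,
    DifferentiableOn ℂ (fun z : (Fin 2 → ℂ) × (Fin 2 → ℂ) => r z.1 z.2 ε) (complexNhd κ)
  periodic : ∀ ε ∈ Set.Ioo 0 κ, ∀ x ζ, (x, ζ) ∈ complexNhd κ → ∀ k : Fin 2 → ℤ,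
    r (fun i => x i + 2 * Real.pi * (k i : ℂ)) ζ ε = r x ζ ε
  bound : ∀ ε ∈ Set.Ioo 0 κ, ∀ x ζ, (x, ζ) ∈ complexNhd κ →
    ‖r x ζ ε‖ ≤ K * (ε ^ M + ‖ζ‖ ^ N)

/-- The gradient `u'_x` of a function on `ℝ²`. -/
def grad (u : (Fin 2 → ℝ) → ℂ) (x : Fin 2 → ℝ) : Fin 2 → ℂ :=
  fun i => fderiv ℝ u x (Pi.single i 1)

/-- Functions on `ℝ²` that are `(2πℤ)²`-periodic, that is, functions on `𝕋² = ℝ²/(2πℤ)²`. -/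
def TorusPeriodic {E : Type*} (u : (Fin 2 → ℝ) → E) : Prop :=
  ∀ (k : Fin 2 → ℤ) (x : Fin 2 → ℝ), u (fun i => x i + 2 * Real.pi * (k i : ℝ)) = u x

/-- A grad-periodic function: a smooth multi-valued function on `𝕋²` (given by its lift to `ℝ²`)
whose gradient is single-valued on `𝕋²`. -/
def GradPeriodic (u : (Fin 2 → ℝ) → ℂ) : Prop :=
  ContDiff ℝ ∞ u ∧ TorusPeriodic (grad u)

/-- The Fourier coefficient `(2π)⁻² ∫_{[0,2π]²} u(x) e^{-i k·x} dx`. -/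
def fourierCoeffTorus (u : (Fin 2 → ℝ) → ℂ) (k : Fin 2 → ℤ) : ℂ :=
  (1 / (2 * Real.pi) ^ 2 : ℂ) *
    ∫ x in Set.Icc (0 : Fin 2 → ℝ) (fun _ => 2 * Real.pi),
      u x * Complex.exp (-(I * ∑ i, (k i : ℂ) * (x i : ℂ)))

/-- The `H^s(𝕋²)`-norm of a periodic `ℂ²`-valued function, with value `∞` when the function does
not belong to `H^s`. -/
def sobolevNorm (s : ℝ) (v : (Fin 2 → ℝ) → Fin 2 → ℂ) : ℝ≥0∞ :=
  (∑' k : Fin 2 → ℤ, ENNReal.ofReal ((1 + ∑ i, (k i : ℝ) ^ 2) ^ s) *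
    ∑ j, ‖fourierCoeffTorus (fun x => v x j) k‖ₑ ^ 2) ^ (1 / 2 : ℝ)

/-- `y₁, y₂` are linear functions of `x ∈ ℝ²` with `l_j · ∂_x y_k = δ_{jk}`. -/
def IsDualPair (l : Fin 2 → Fin 2 → ℂ) (y : Fin 2 → ((Fin 2 → ℝ) →ₗ[ℝ] ℂ)) : Prop :=
  ∀ j k, ∑ i, l j i * y k (Pi.single i 1) = if j = k then 1 else 0

/-- `w^* = (ε y₁ + y₂ / i) / 2`. -/
def wStar (ε : ℝ) (y : Fin 2 → ((Fin 2 → ℝ) →ₗ[ℝ] ℂ)) (x : Fin 2 → ℝ) : ℂ :=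
  (1 / 2) * ((ε : ℂ) * y 0 x + (1 / I) * y 1 x)

/-- The phase `φ(x) = x·ξ + ε̃ ρ(x)`; `e` stands for `ε̃`. -/
def phase (ξ : Fin 2 → ℝ) (e : ℝ) (ρ : (Fin 2 → ℝ) → ℂ) (x : Fin 2 → ℝ) : ℂ :=
  ((∑ i, x i * ξ i : ℝ) : ℂ) + (e : ℂ) * ρ x

/-- `φ` solves `p(x, φ'_x(x), ε) = z` on `ℝ²`, where it is part of the claim that `(x, φ'_x(x))`
stays in the domain of the symbol. -/
def SolvesHJ (κ : ℝ) (P : (Fin 2 → ℂ) → (Fin 2 → ℂ) → ℝ → ℂ) (ε : ℝ) (z : ℂ)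
    (φ : (Fin 2 → ℝ) → ℂ) : Prop :=
  ∀ x : Fin 2 → ℝ, ((fun i => (x i : ℂ)), grad φ x) ∈ complexNhd κ ∧
    P (fun i => (x i : ℂ)) (grad φ x) ε = z

end

end HamiltonJacobi

/-!
Writing `φ = x · ξ + ε̃ ρ`, the Hamilton–Jacobi equation becomes a transport equation for the
gradient of `ρ`: the complex vector field `p'_ξ + iε q'_ξ`, applied to `ρ`, has to equal a sum of
the quadratic Taylor remainder of the normal form and of `r`, both evaluated at the unknown
gradient. By the linear independence of `p'_ξ` and `Re q'_ξ`, the symbol of this vector field is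
bounded below by a multiple of `ε |k|` at every nonzero frequency `k`, so the transport equation can
be solved for the gradient with a loss of `1 / ε`; the zero mode of the right hand side, which no
periodic function can produce, is accounted for by a multiple of `w^*`.

The gradient is sought in an algebra of Fourier series that converge absolutely with exponential
weights. Polynomials act on this algebra, Cauchy estimates show that the holomorphic function `r`
does too, and all Sobolev norms are dominated by its norm. On a ball of radius comparable to
`(ε^M + ε̃^N) / (ε ε̃)` the map that solves the transport equation is a contraction as soon as
`(ε^M + ε̃^N) / (ε min(ε, ε̃))` is small: division by `ε` controls the quadratic term, division by
`ε̃` controls `r`.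
-/

namespace HamiltonJacobi

noncomputable section

/-! ### Weighted convolution algebras -/

/-- A submultiplicative weight on an additive monoid. -/
structure BeurlingWeight (G : Type*) [AddMonoid G] where
  toFun : G → ℝ
  pos' : ∀ k, 0 < toFun k
  map_zero' : toFun 0 = 1
  map_add_le' : ∀ j k, toFun (j + k) ≤ toFun j * toFun k

namespace BeurlingWeight

variable {G : Type*} [AddMonoid G]

instance : CoeFun (BeurlingWeight G) fun _ => G → ℝ := ⟨toFun⟩

variable (w : BeurlingWeight G)

theorem pos (k : G) : 0 < w k := w.pos' k

theorem map_zero : w 0 = 1 := w.map_zero'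

theorem map_add_le (j k : G) : w (j + k) ≤ w j * w k := w.map_add_le' j k

theorem ofReal_ne_zero (k : G) : (w k : ℂ) ≠ 0 := Complex.ofReal_ne_zero.mpr (w.pos k).ne'

end BeurlingWeight

/-- The Beurling algebra of a weight `w`: formal sums `∑ c_k e_k` with `∑ |c_k| w(k) < ∞`,
multiplied by `e_j e_k = e_{j+k}`. An element is stored as the `ℓ¹` sequence `c_k w(k)`, so that
the norm is that of `ℓ¹`. -/
def BeurlingAlgebra {G : Type*} [AddMonoid G] (_ : BeurlingWeight G) : Type _ :=
  lp (fun _ : G => ℂ) 1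

namespace BeurlingAlgebra

section Module

variable {G : Type*} [AddMonoid G] {w : BeurlingWeight G}

instance : NormedAddCommGroup (BeurlingAlgebra w) :=
  inferInstanceAs (NormedAddCommGroup (lp (fun _ : G => ℂ) 1))

instance : NormedSpace ℂ (BeurlingAlgebra w) :=
  inferInstanceAs (NormedSpace ℂ (lp (fun _ : G => ℂ) 1))

instance : CompleteSpace (BeurlingAlgebra w) :=
  inferInstanceAs (CompleteSpace (lp (fun _ : G => ℂ) 1))

open scoped Classical in
/-- The generator `e_k`. -/
def mode (k : G) : BeurlingAlgebra w := lp.single (E := fun _ => ℂ) 1 k (w k : ℂ)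

theorem norm_mode (k : G) : ‖(mode k : BeurlingAlgebra w)‖ = w k := by
  classical
  exact (lp.norm_single (E := fun _ : G => ℂ) (p := 1) (by simp) k (w k : ℂ)).trans
    (Complex.norm_of_nonneg (w.pos k).le)

/-- The coefficient `c_k` of `∑ c_k e_k`. -/
def coeff (k : G) : BeurlingAlgebra w →L[ℂ] ℂ :=
  (w k : ℂ)⁻¹ • lp.evalCLM ℂ (fun _ : G => ℂ) 1 k

theorem coeff_mode_self (k : G) : coeff k (mode k : BeurlingAlgebra w) = 1 := by
  classical
  change (w k : ℂ)⁻¹ * lp.single (E := fun _ => ℂ) 1 k (w k : ℂ) k = 1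
  rw [lp.single_apply_self, inv_mul_cancel₀ (w.ofReal_ne_zero k)]

theorem coeff_mode_of_ne {j k : G} (h : k ≠ j) : coeff k (mode j : BeurlingAlgebra w) = 0 := by
  classical
  change (w k : ℂ)⁻¹ * lp.single (E := fun _ => ℂ) 1 j (w j : ℂ) k = 0
  rw [lp.single_apply_ne _ _ _ h, mul_zero]

theorem hasSum_norm_coeff_mul (f : BeurlingAlgebra w) :
    HasSum (fun k => ‖coeff k f‖ * w k) ‖f‖ := by
  have hl1 (g : lp (fun _ : G => ℂ) 1) : HasSum (fun k => ‖g k‖) ‖g‖ := by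
    simpa using lp.hasSum_norm (by simp) g
  refine (hl1 f).congr_fun fun k => ?_
  change ‖(w k : ℂ)⁻¹ * (show lp (fun _ : G => ℂ) 1 from f) k‖ * w k = _
  rw [norm_mul, norm_inv, Complex.norm_of_nonneg (w.pos k).le, mul_comm, ← mul_assoc,
    mul_inv_cancel₀ (w.pos k).ne', one_mul]

theorem hasSum_coeff_smul_mode (f : BeurlingAlgebra w) :
    HasSum (fun k => coeff k f • (mode k : BeurlingAlgebra w)) f := by
  classical
  refine (lp.hasSum_single (E := fun _ : G => ℂ) ENNReal.one_ne_top f).congr_fun fun k => ?_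
  refine (lp.single_smul (E := fun _ : G => ℂ) 1 k (coeff k f) (w k : ℂ)).symm.trans ?_
  congr 1
  change (w k : ℂ)⁻¹ * (show lp (fun _ : G => ℂ) 1 from f) k * w k = _
  rw [mul_comm, mul_inv_cancel_left₀ (w.ofReal_ne_zero k)]

variable {E : Type*} [NormedAddCommGroup E] [NormedSpace ℂ E]

theorem hom_ext {S T : BeurlingAlgebra w →L[ℂ] E} (h : ∀ k, S (mode k) = T (mode k)) : S = T := by
  ext f
  have hS := (hasSum_coeff_smul_mode f).mapL S
  have hT := (hasSum_coeff_smul_mode f).mapL T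
  simp only [map_smul, h] at hS hT
  exact hS.unique hT

theorem summable_norm_coeff_smul {e : G → E} {C : ℝ} (he : ∀ k, ‖e k‖ ≤ C * w k)
    (f : BeurlingAlgebra w) : Summable fun k => ‖coeff k f • e k‖ := by
  refine Summable.of_nonneg_of_le (fun _ => norm_nonneg _) (fun k => ?_)
    ((hasSum_norm_coeff_mul f).summable.mul_left C)
  rw [norm_smul, mul_left_comm]
  exact mul_le_mul_of_nonneg_left (he k) (norm_nonneg _)

variable [CompleteSpace E]

/-- The continuous linear map with values `e k` on the generators. -/
def lift (e : G → E) (C : ℝ) (he : ∀ k, ‖e k‖ ≤ C * w k) : BeurlingAlgebra w →L[ℂ] E :=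
  LinearMap.mkContinuous
    { toFun := fun f => ∑' k, coeff k f • e k
      map_add' := fun f g => by
        simp only [map_add, add_smul]
        exact (summable_norm_coeff_smul he f).of_norm.tsum_add
          (summable_norm_coeff_smul he g).of_norm
      map_smul' := fun c f => by
        simp only [map_smul, smul_assoc]
        exact (summable_norm_coeff_smul he f).of_norm.tsum_const_smul c }
    C fun f => tsum_of_norm_bounded ((hasSum_norm_coeff_mul f).mul_left C) fun k => by
      rw [norm_smul, mul_left_comm]
      exact mul_le_mul_of_nonneg_left (he k) (norm_nonneg _)

variable (e : G → E) (C : ℝ) (he : ∀ k, ‖e k‖ ≤ C * w k)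

theorem hasSum_lift (f : BeurlingAlgebra w) : HasSum (fun k => coeff k f • e k) (lift e C he f) :=
  (summable_norm_coeff_smul he f).of_norm.hasSum

theorem lift_mode (k : G) : lift e C he (mode k) = e k := by
  have h := hasSum_single (f := fun j => coeff j (mode k : BeurlingAlgebra w) • e j) k
    fun j hj => by rw [coeff_mode_of_ne hj, zero_smul]
  rw [(hasSum_lift e C he (mode k)).unique h, coeff_mode_self, one_smul]

theorem norm_lift_le : ‖lift e C he‖ ≤ C := by
  have hC : 0 ≤ C := by simpa [w.map_zero] using (norm_nonneg _).trans (he 0)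
  exact LinearMap.mkContinuous_norm_le _ hC _

end Module

section Multiplier

variable {G : Type*} [AddMonoid G] {w : BeurlingWeight G} (m : G → ℂ) (C : ℝ) (hm : ∀ k, ‖m k‖ ≤ C)

/-- The diagonal operator `∑ c_k e_k ↦ ∑ m_k c_k e_k`; for exponentials this is the Fourier
multiplier with symbol `m`. -/
def multiplier : BeurlingAlgebra w →L[ℂ] BeurlingAlgebra w :=
  lift (fun k => m k • mode k) C fun k => by
    rw [norm_smul, norm_mode]
    exact mul_le_mul_of_nonneg_right (hm k) (w.pos k).le

theorem norm_multiplier_le : ‖(multiplier m C hm : BeurlingAlgebra w →L[ℂ] _)‖ ≤ C :=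
  norm_lift_le _ _ _

theorem coeff_multiplier (k : G) (f : BeurlingAlgebra w) :
    coeff k (multiplier m C hm f) = m k * coeff k f := by
  have h : (coeff k).comp (multiplier m C hm) = m k • (coeff k : BeurlingAlgebra w →L[ℂ] ℂ) := by
    refine hom_ext fun j => ?_
    simp only [multiplier, ContinuousLinearMap.comp_apply, lift_mode, map_smul, smul_apply]
    obtain rfl | hkj := eq_or_ne k j
    · rfl
    · rw [coeff_mode_of_ne hkj, smul_zero, smul_zero]
  exact DFunLike.congr_fun h f

end Multiplier

section Algebra

variable {G : Type*} [AddCommMonoid G] {w : BeurlingWeight G}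

theorem norm_mode_add_le (j k : G) : ‖(mode (j + k) : BeurlingAlgebra w)‖ ≤ w j * w k :=
  (norm_mode _).trans_le (w.map_add_le j k)

variable (w) in
/-- The multiplication of the Beurling algebra as a bilinear map. -/
def mulL : BeurlingAlgebra w →L[ℂ] BeurlingAlgebra w →L[ℂ] BeurlingAlgebra w :=
  lift (fun j => lift (fun k => mode (j + k)) (w j) (norm_mode_add_le j)) 1
    fun _ => (norm_lift_le _ _ _).trans_eq (one_mul _).symm

theorem mulL_mode (j k : G) : mulL w (mode j) (mode k) = mode (j + k) := by
  rw [mulL, lift_mode, lift_mode]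

theorem mulL_comm (f g : BeurlingAlgebra w) : mulL w f g = mulL w g f := by
  have h : mulL w = (mulL w).flip := hom_ext fun j => hom_ext fun k => by
    rw [ContinuousLinearMap.flip_apply, mulL_mode, mulL_mode, add_comm]
  exact DFunLike.congr_fun (DFunLike.congr_fun h f) g

theorem mulL_assoc (f g h : BeurlingAlgebra w) :
    mulL w (mulL w f g) h = mulL w f (mulL w g h) := by
  let L := BeurlingAlgebra w →L[ℂ] BeurlingAlgebra w
  have key : (ContinuousLinearMap.compL ℂ (BeurlingAlgebra w) (BeurlingAlgebra w) L (mulL w)).comp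
        (mulL w) =
      (ContinuousLinearMap.compL ℂ (BeurlingAlgebra w) L L).flip (mulL w) ∘L
        (ContinuousLinearMap.compL ℂ (BeurlingAlgebra w) (BeurlingAlgebra w) (BeurlingAlgebra w) ∘L
          mulL w) :=
    hom_ext fun i => hom_ext fun j => hom_ext fun k => by
      simp only [L, ContinuousLinearMap.comp_apply, ContinuousLinearMap.flip_apply,
        ContinuousLinearMap.compL_apply, mulL_mode, add_assoc]
  exact DFunLike.congr_fun (DFunLike.congr_fun (DFunLike.congr_fun key f) g) h

theorem mulL_mode_zero (f : BeurlingAlgebra w) : mulL w (mode 0) f = f := by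
  have h : mulL w (mode 0) = ContinuousLinearMap.id ℂ (BeurlingAlgebra w) := hom_ext fun k => by
    rw [mulL_mode, zero_add, ContinuousLinearMap.id_apply]
  exact DFunLike.congr_fun h f

instance : NormedCommRing (BeurlingAlgebra w) :=
  { (inferInstance : NormedAddCommGroup (BeurlingAlgebra w)) with
    mul := fun f g => mulL w f g
    one := mode 0
    left_distrib := fun f g h => map_add (mulL w f) g h
    right_distrib := fun f g h => (mulL w).map_add₂ f g h
    zero_mul := fun f => (mulL w).map_zero₂ f
    mul_zero := fun f => map_zero (mulL w f)
    mul_assoc := mulL_assoc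
    one_mul := mulL_mode_zero
    mul_one := fun f => (mulL_comm _ _).trans (mulL_mode_zero f)
    mul_comm := mulL_comm
    norm_mul_le := fun f g => ((mulL w).le_of_opNorm₂_le_of_le (norm_lift_le _ _ _) le_rfl
      le_rfl).trans_eq (by rw [one_mul]) }

instance : Algebra ℂ (BeurlingAlgebra w) :=
  Algebra.ofModule (fun c f g => (mulL w).map_smul₂ c f g) fun c f g => map_smul (mulL w f) c g

instance : NormedAlgebra ℂ (BeurlingAlgebra w) where
  norm_smul_le := norm_smul_le

instance : NormOneClass (BeurlingAlgebra w) := ⟨(norm_mode 0).trans w.map_zero⟩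

section Character

variable (χ : AddChar G ℂ) (hχ : ∀ k, ‖χ k‖ ≤ w k)

/-- The evaluation `∑ c_k e_k ↦ ∑ c_k χ(k)` at a character `χ` dominated by the weight, as a
continuous linear functional. -/
def evalCharL : BeurlingAlgebra w →L[ℂ] ℂ :=
  lift χ 1 fun k => (hχ k).trans_eq (one_mul _).symm

/-- The evaluation `∑ c_k e_k ↦ ∑ c_k χ(k)` as a character of the algebra. -/
def evalChar : BeurlingAlgebra w →ₐ[ℂ] ℂ :=
  AlgHom.ofLinearMap (evalCharL χ hχ : BeurlingAlgebra w →ₗ[ℂ] ℂ)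
    ((lift_mode _ _ _ 0).trans χ.map_zero_eq_one) fun f g => by
      have h : (ContinuousLinearMap.compL ℂ (BeurlingAlgebra w) _ ℂ (evalCharL χ hχ)).comp
          (mulL w) = ((ContinuousLinearMap.mul ℂ ℂ).comp (evalCharL χ hχ)).flip.comp
            (evalCharL χ hχ) := hom_ext fun j => hom_ext fun k => by
        simp only [ContinuousLinearMap.comp_apply, ContinuousLinearMap.flip_apply,
          ContinuousLinearMap.compL_apply, mulL_mode, ContinuousLinearMap.mul_apply',
          evalCharL, lift_mode, χ.map_add_eq_mul, mul_comm]
      exact (DFunLike.congr_fun (DFunLike.congr_fun h f) g).trans (mul_comm _ _)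

theorem hasSum_evalChar (f : BeurlingAlgebra w) :
    HasSum (fun k => coeff k f * χ k) (evalChar χ hχ f) := hasSum_lift _ _ _ f

theorem evalChar_mode (k : G) : evalChar χ hχ (mode k) = χ k := lift_mode _ _ _ k

end Character

end Algebra

end BeurlingAlgebra

/-! ### Cauchy integrals in a commutative Banach algebra -/

section CauchyCalculus

variable {A : Type*} [NormedCommRing A] [NormedAlgebra ℂ A] [CompleteSpace A]

theorem map_circleIntegral (χ : A →ₐ[ℂ] ℂ) {G : ℂ → A}
    (hG : CircleIntegrable G 0 1) :
    χ (∮ z in C(0, 1), G z) = ∮ z in C(0, 1), χ (G z) := by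
  have h := χ.toContinuousLinearMap.intervalIntegral_comp_comm hG.out
  simpa [circleIntegral] using h.symm

variable [NormOneClass A] {r : ℝ} {u v : A} {z : ℂ}

theorem mem_resolventSet_of_mem_sphere (hv : ‖v‖ < 1) (hz : z ∈ Metric.sphere (0 : ℂ) 1) :
    z ∈ resolventSet ℂ v :=
  spectrum.mem_resolventSet_of_norm_lt (by rwa [mem_sphere_zero_iff_norm.mp hz])

theorem resolvent_mul_sub (hv : ‖v‖ < 1) (hz : z ∈ Metric.sphere (0 : ℂ) 1) :
    resolvent v z * (algebraMap ℂ A z - v) = 1 :=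
  Ring.inverse_mul_cancel _ (mem_resolventSet_of_mem_sphere hv hz)

theorem continuousOn_resolvent (hv : ‖v‖ < 1) :
    ContinuousOn (resolvent v) (Metric.sphere (0 : ℂ) 1) := fun _ hz =>
  (spectrum.hasDerivAt_resolvent_const_left (mem_resolventSet_of_mem_sphere hv hz)).continuousAt
    |>.continuousWithinAt

theorem map_resolvent (χ : A →ₐ[ℂ] ℂ) (hv : ‖v‖ < 1) (hz : z ∈ Metric.sphere (0 : ℂ) 1) :
    χ (resolvent v z) = (z - χ v)⁻¹ := by
  have h := congrArg χ (resolvent_mul_sub hv hz)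
  rw [map_mul, map_sub, AlgHom.commutes, map_one] at h
  exact eq_inv_of_mul_eq_one_left h

theorem norm_resolvent_le (hr : r < 1) (hv : ‖v‖ ≤ r) (hz : z ∈ Metric.sphere (0 : ℂ) 1) :
    ‖resolvent v z‖ ≤ (1 - r)⁻¹ := by
  have hsmul : z • resolvent v z = 1 + resolvent v z * v := by
    rw [← resolvent_mul_sub (hv.trans_lt hr) hz, Algebra.smul_def]
    ring
  have hle : ‖resolvent v z‖ ≤ 1 + ‖resolvent v z‖ * r :=
    calc ‖resolvent v z‖ = ‖z • resolvent v z‖ := by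
          rw [norm_smul, mem_sphere_zero_iff_norm.mp hz, one_mul]
      _ ≤ ‖(1 : A)‖ + ‖resolvent v z * v‖ := hsmul ▸ norm_add_le _ _
      _ ≤ 1 + ‖resolvent v z‖ * r := by
        rw [norm_one]
        gcongr
        exact norm_mul_le_of_le le_rfl hv
  rw [← one_div, le_div_iff₀ (sub_pos.mpr hr)]
  linarith

theorem norm_resolvent_sub_le (hr : r < 1) (hu : ‖u‖ ≤ r) (hv : ‖v‖ ≤ r)
    (hz : z ∈ Metric.sphere (0 : ℂ) 1) :
    ‖resolvent u z - resolvent v z‖ ≤ (1 - r)⁻¹ ^ 2 * ‖u - v‖ := by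
  have resolvent_identity :
      resolvent u z - resolvent v z = resolvent u z * resolvent v z * (u - v) := by
    linear_combination (-resolvent u z) * resolvent_mul_sub (hv.trans_lt hr) hz +
      resolvent v z * resolvent_mul_sub (hu.trans_lt hr) hz
  rw [resolvent_identity, sq]
  exact norm_mul_le_of_le (norm_mul_le_of_le (norm_resolvent_le hr hu hz)
    (norm_resolvent_le hr hv hz)) le_rfl

/-- The Cauchy integral `(2πi)⁻¹ ∮ G(z) (z - v)⁻¹ dz` over the unit circle, with values in `A`. -/
def cauchyCalc (G : ℂ → A) (v : A) : A :=
  (2 * Real.pi * I : ℂ)⁻¹ • ∮ z in C(0, 1), G z * resolvent v z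

variable {G : ℂ → A} {B : ℝ}

theorem circleIntegrable_mul_resolvent (hG : ContinuousOn G (Metric.sphere 0 1)) (hv : ‖v‖ < 1) :
    CircleIntegrable (fun z => G z * resolvent v z) 0 1 :=
  (hG.mul (continuousOn_resolvent hv)).circleIntegrable zero_le_one

theorem norm_cauchyCalc_le (hr : r < 1) (hB : ∀ z ∈ Metric.sphere (0 : ℂ) 1, ‖G z‖ ≤ B)
    (hv : ‖v‖ ≤ r) : ‖cauchyCalc G v‖ ≤ B * (1 - r)⁻¹ := by
  have h := circleIntegral.norm_two_pi_i_inv_smul_integral_le_of_norm_le_const zero_le_one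
    fun z hz => norm_mul_le_of_le (hB z hz) (norm_resolvent_le hr hv hz)
  rwa [one_mul] at h

theorem cauchyCalc_sub {G' : ℂ → A} (hG : ContinuousOn G (Metric.sphere 0 1))
    (hG' : ContinuousOn G' (Metric.sphere 0 1)) (hv : ‖v‖ < 1) :
    cauchyCalc G v - cauchyCalc G' v = cauchyCalc (fun z => G z - G' z) v := by
  simp only [cauchyCalc]
  rw [← smul_sub, ← circleIntegral.integral_sub (circleIntegrable_mul_resolvent hG hv)
    (circleIntegrable_mul_resolvent hG' hv)]
  simp only [sub_mul]

theorem norm_cauchyCalc_sub_le (hr : r < 1) (hG : ContinuousOn G (Metric.sphere 0 1))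
    (hB : ∀ z ∈ Metric.sphere (0 : ℂ) 1, ‖G z‖ ≤ B) (hu : ‖u‖ ≤ r) (hv : ‖v‖ ≤ r) :
    ‖cauchyCalc G u - cauchyCalc G v‖ ≤ B * ((1 - r)⁻¹ ^ 2 * ‖u - v‖) := by
  rw [cauchyCalc, cauchyCalc, ← smul_sub, ← circleIntegral.integral_sub
    (circleIntegrable_mul_resolvent hG (hu.trans_lt hr))
    (circleIntegrable_mul_resolvent hG (hv.trans_lt hr))]
  simp only [← mul_sub]
  have h := circleIntegral.norm_two_pi_i_inv_smul_integral_le_of_norm_le_const zero_le_one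
    fun z hz => norm_mul_le_of_le (hB z hz) (norm_resolvent_sub_le hr hu hv hz)
  rwa [one_mul] at h

theorem map_cauchyCalc (χ : A →ₐ[ℂ] ℂ) (hG : ContinuousOn G (Metric.sphere 0 1)) (hv : ‖v‖ < 1)
    {g : ℂ → ℂ} (hg : DiffContOnCl ℂ g (Metric.ball 0 1))
    (hχ : ∀ z ∈ Metric.sphere (0 : ℂ) 1, χ (G z) = g z) : χ (cauchyCalc G v) = g (χ v) := by
  have hχv : χ v ∈ Metric.ball (0 : ℂ) 1 :=
    mem_ball_zero_iff.mpr ((AlgHom.norm_apply_le_self χ v).trans_lt hv)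
  rw [cauchyCalc, map_smul, map_circleIntegral χ (circleIntegrable_mul_resolvent hG hv),
    circleIntegral.integral_congr zero_le_one (g := fun z => (z - χ v)⁻¹ • g z) fun z hz => by
      simp only [map_mul, map_resolvent χ hv hz, hχ z hz, smul_eq_mul, mul_comm],
    hg.circleIntegral_sub_inv_smul hχv, smul_smul, inv_mul_cancel₀ two_pi_I_ne_zero, one_smul]

theorem continuousOn_cauchyCalc {G : ℂ → ℂ → A}
    (hG : ContinuousOn (Function.uncurry G) (Metric.sphere 0 1 ×ˢ Metric.sphere 0 1))
    (hv : ‖v‖ < 1) : ContinuousOn (fun z => cauchyCalc (G z) v) (Metric.sphere (0 : ℂ) 1) := by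
  rw [continuousOn_iff_continuous_domRestrict]
  refine Continuous.const_smul
    (intervalIntegral.continuous_parametric_intervalIntegral_of_continuous'
    (f := fun (z : Metric.sphere (0 : ℂ) 1) θ => deriv (circleMap 0 1) θ •
      (G z (circleMap 0 1 θ) * resolvent v (circleMap 0 1 θ))) ?_ _ _) _
  have hmem (θ : ℝ) : circleMap (0 : ℂ) 1 θ ∈ Metric.sphere (0 : ℂ) 1 :=
    circleMap_mem_sphere _ zero_le_one θ
  have hsymbol : Continuous fun p : Metric.sphere (0 : ℂ) 1 × ℝ => G p.1 (circleMap 0 1 p.2) :=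
    hG.comp_continuous (f := fun p : Metric.sphere (0 : ℂ) 1 × ℝ => ((p.1 : ℂ), circleMap 0 1 p.2))
      (by fun_prop) fun p => ⟨p.1.2, hmem p.2⟩
  have hresolvent : Continuous fun p : Metric.sphere (0 : ℂ) 1 × ℝ =>
      resolvent v (circleMap 0 1 p.2) :=
    (continuousOn_resolvent hv).comp_continuous (by fun_prop) fun p => hmem p.2
  have hderiv : Continuous fun p : Metric.sphere (0 : ℂ) 1 × ℝ => deriv (circleMap 0 1) p.2 := by
    simp only [deriv_circleMap]
    fun_prop
  exact hderiv.smul (hsymbol.mul hresolvent)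

/-- The iterated Cauchy integral over the torus `|z₀| = |z₁| = 1`. -/
def cauchyCalc₂ (G : ℂ → ℂ → A) (v : Fin 2 → A) : A :=
  cauchyCalc (fun z => cauchyCalc (G z) (v 1)) (v 0)

section TwoVariables

variable {G : ℂ → ℂ → A} {u v : Fin 2 → A}

theorem norm_cauchyCalc₂_le (hr : r < 1)
    (hB : ∀ z ∈ Metric.sphere (0 : ℂ) 1, ∀ w ∈ Metric.sphere (0 : ℂ) 1, ‖G z w‖ ≤ B)
    (hv : ‖v‖ ≤ r) : ‖cauchyCalc₂ G v‖ ≤ B * (1 - r)⁻¹ * (1 - r)⁻¹ :=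
  norm_cauchyCalc_le hr (fun z hz => norm_cauchyCalc_le hr (hB z hz)
    ((norm_le_pi_norm v 1).trans hv)) ((norm_le_pi_norm v 0).trans hv)

theorem norm_cauchyCalc₂_sub_le (hr : r < 1)
    (hG : ContinuousOn (Function.uncurry G) (Metric.sphere 0 1 ×ˢ Metric.sphere 0 1))
    (hB : ∀ z ∈ Metric.sphere (0 : ℂ) 1, ∀ w ∈ Metric.sphere (0 : ℂ) 1, ‖G z w‖ ≤ B)
    (hu : ‖u‖ ≤ r) (hv : ‖v‖ ≤ r) :
    ‖cauchyCalc₂ G u - cauchyCalc₂ G v‖ ≤ 2 * B * (1 - r)⁻¹ ^ 3 * ‖u - v‖ := by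
  have hui (i) := (norm_le_pi_norm u i).trans hu
  have hvi (i) := (norm_le_pi_norm v i).trans hv
  have hB0 : 0 ≤ B := (norm_nonneg _).trans (hB 1 (by simp) 1 (by simp))
  have : 0 ≤ (1 - r)⁻¹ := inv_nonneg.mpr (by linarith)
  have hcont {a : A} (ha : ‖a‖ ≤ r) := continuousOn_cauchyCalc hG (ha.trans_lt hr)
  have change_outer : ‖cauchyCalc₂ G u - cauchyCalc (fun z => cauchyCalc (G z) (u 1)) (v 0)‖ ≤
      B * (1 - r)⁻¹ * ((1 - r)⁻¹ ^ 2 * ‖u 0 - v 0‖) :=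
    norm_cauchyCalc_sub_le hr (hcont (hui 1))
      (fun z hz => norm_cauchyCalc_le hr (hB z hz) (hui 1)) (hui 0) (hvi 0)
  have change_inner : ‖cauchyCalc (fun z => cauchyCalc (G z) (u 1)) (v 0) - cauchyCalc₂ G v‖ ≤
      B * ((1 - r)⁻¹ ^ 2 * ‖u 1 - v 1‖) * (1 - r)⁻¹ := by
    rw [cauchyCalc₂, cauchyCalc_sub (hcont (hui 1)) (hcont (hvi 1)) ((hvi 0).trans_lt hr)]
    exact norm_cauchyCalc_le hr (fun z hz => norm_cauchyCalc_sub_le hr (hG.uncurry_left z hz)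
      (hB z hz) (hui 1) (hvi 1)) (hvi 0)
  calc _ ≤ B * (1 - r)⁻¹ * ((1 - r)⁻¹ ^ 2 * ‖u 0 - v 0‖) +
          B * ((1 - r)⁻¹ ^ 2 * ‖u 1 - v 1‖) * (1 - r)⁻¹ :=
        (norm_sub_le_norm_sub_add_norm_sub _ _ _).trans (add_le_add change_outer change_inner)
    _ ≤ B * (1 - r)⁻¹ * ((1 - r)⁻¹ ^ 2 * ‖u - v‖) +
          B * ((1 - r)⁻¹ ^ 2 * ‖u - v‖) * (1 - r)⁻¹ := by
        gcongr
        exacts [norm_le_pi_norm (u - v) 0, norm_le_pi_norm (u - v) 1]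
    _ = 2 * B * (1 - r)⁻¹ ^ 3 * ‖u - v‖ := by ring

theorem map_cauchyCalc₂ (χ : A →ₐ[ℂ] ℂ)
    (hG : ContinuousOn (Function.uncurry G) (Metric.sphere 0 1 ×ˢ Metric.sphere 0 1))
    (hv : ‖v‖ < 1) {g : ℂ → ℂ → ℂ}
    (hg₁ : ∀ z ∈ Metric.sphere (0 : ℂ) 1, DiffContOnCl ℂ (g z) (Metric.ball 0 1))
    (hg₀ : ∀ w ∈ Metric.ball (0 : ℂ) 1, DiffContOnCl ℂ (fun z => g z w) (Metric.ball 0 1))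
    (hχ : ∀ z ∈ Metric.sphere (0 : ℂ) 1, ∀ w ∈ Metric.sphere (0 : ℂ) 1, χ (G z w) = g z w) :
    χ (cauchyCalc₂ G v) = g (χ (v 0)) (χ (v 1)) := by
  have hvi (i) := (norm_le_pi_norm v i).trans_lt hv
  have hχv : χ (v 1) ∈ Metric.ball (0 : ℂ) 1 :=
    mem_ball_zero_iff.mpr ((AlgHom.norm_apply_le_self χ _).trans_lt (hvi 1))
  exact map_cauchyCalc χ (continuousOn_cauchyCalc hG (hvi 1)) (hvi 0) (hg₀ _ hχv) fun z hz =>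
    map_cauchyCalc χ (hG.uncurry_left z hz) (hvi 1) (hg₁ z hz) (hχ z hz)

end TwoVariables

end CauchyCalculus

/-! ### Polynomials in a commutative Banach algebra -/

section PolynomialTaylor

open MvPolynomial

variable {𝕜 σ A : Type*} [Fintype σ]

/-- The remainder `P(ξ + h) - P(ξ) - P'(ξ) h` of the first order Taylor expansion of a polynomial
with values in a commutative algebra. -/
def taylorRemainder [CommRing 𝕜] [CommRing A] [Algebra 𝕜 A] (P : MvPolynomial σ 𝕜) (ξ h : σ → A) :
    A :=
  aeval (ξ + h) P - aeval ξ P - ∑ i, aeval ξ (pderiv i P) * h i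

section Algebra

variable [CommRing 𝕜] [CommRing A] [Algebra 𝕜 A]

theorem taylorRemainder_zero (P : MvPolynomial σ 𝕜) (ξ : σ → A) : taylorRemainder P ξ 0 = 0 := by
  simp [taylorRemainder]

theorem taylorRemainder_C (c : 𝕜) (ξ h : σ → A) : taylorRemainder (C c) ξ h = 0 := by
  simp [taylorRemainder]

theorem taylorRemainder_add (P Q : MvPolynomial σ 𝕜) (ξ h : σ → A) :
    taylorRemainder (P + Q) ξ h = taylorRemainder P ξ h + taylorRemainder Q ξ h := by
  simp only [taylorRemainder, map_add, add_mul, Finset.sum_add_distrib]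
  ring

theorem taylorRemainder_mul_X (P : MvPolynomial σ 𝕜) (j : σ) (ξ h : σ → A) :
    taylorRemainder (P * X j) ξ h =
      taylorRemainder P ξ h * ξ j + (aeval (ξ + h) P - aeval ξ P) * h j := by
  classical
  have leibniz : ∑ i, aeval ξ (pderiv i (P * X j)) * h i =
      (∑ i, aeval ξ (pderiv i P) * h i) * ξ j + aeval ξ P * h j := by
    have hX : ∑ i, aeval ξ P * aeval ξ (pderiv i (X j : MvPolynomial σ 𝕜)) * h i =
        aeval ξ P * h j := by
      rw [Finset.sum_eq_single j (fun i _ hij => by simp [pderiv_X, hij.symm]) (by simp)]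
      simp
    simp only [pderiv_mul, map_add, map_mul, aeval_X, add_mul, Finset.sum_add_distrib, hX,
      Finset.sum_mul, mul_right_comm _ (ξ j)]
  rw [taylorRemainder, taylorRemainder, leibniz, map_mul, map_mul, aeval_X, aeval_X, Pi.add_apply]
  ring

theorem map_taylorRemainder {B : Type*} [CommRing B] [Algebra 𝕜 B] (χ : A →ₐ[𝕜] B)
    (P : MvPolynomial σ 𝕜) (ξ h : σ → A) :
    χ (taylorRemainder P ξ h) = taylorRemainder P (χ ∘ ξ) (χ ∘ h) := by
  have hχ (u : σ → A) (P : MvPolynomial σ 𝕜) : χ (aeval u P) = aeval (χ ∘ u) P := by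
    rw [← AlgHom.comp_apply, comp_aeval]
    rfl
  have hadd : χ ∘ (ξ + h) = χ ∘ ξ + χ ∘ h := funext fun i => map_add χ (ξ i) (h i)
  simp only [taylorRemainder, map_sub, map_sum, map_mul, hχ, hadd, Function.comp_apply]

end Algebra

variable [NormedField 𝕜]

theorem exists_norm_aeval_sub_le (A : Type*) [NormedCommRing A] [NormedAlgebra 𝕜 A]
    (P : MvPolynomial σ 𝕜) {R : ℝ} (hR : 0 ≤ R) :
    ∃ C : ℝ, 0 ≤ C ∧ ∀ u v : σ → A, ‖u‖ ≤ R → ‖v‖ ≤ R →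
      ‖aeval u P - aeval v P‖ ≤ C * ‖u - v‖ := by
  induction P using MvPolynomial.induction_on with
  | C c => exact ⟨0, le_rfl, fun u v _ _ => by simp⟩
  | add P Q hP hQ =>
    obtain ⟨C, hC, hP⟩ := hP
    obtain ⟨D, hD, hQ⟩ := hQ
    refine ⟨C + D, by positivity, fun u v hu hv => ?_⟩
    rw [map_add, map_add, add_sub_add_comm, add_mul]
    exact norm_add_le_of_le (hP u v hu hv) (hQ u v hu hv)
  | mul_X P j hP =>
    obtain ⟨C, hC, hP⟩ := hP
    refine ⟨C * R + (C * R + ‖(aeval 0 P : A)‖), by positivity, fun u v hu hv => ?_⟩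
    have hbound : ‖aeval u P‖ ≤ C * R + ‖(aeval 0 P : A)‖ := by
      have h := hP u 0 hu (by simpa using hR)
      rw [sub_zero] at h
      linarith [norm_le_norm_sub_add (aeval u P) (aeval 0 P : A), mul_le_mul_of_nonneg_left hu hC]
    have hsplit : aeval u (P * X j) - aeval v (P * X j) =
        (aeval u P - aeval v P) * v j + aeval u P * (u j - v j) := by
      simp only [map_mul, aeval_X]
      ring
    rw [hsplit]
    calc _ ≤ C * ‖u - v‖ * R + (C * R + ‖(aeval 0 P : A)‖) * ‖u - v‖ :=
          norm_add_le_of_le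
            (norm_mul_le_of_le (hP u v hu hv) ((norm_le_pi_norm v j).trans hv))
            (norm_mul_le_of_le hbound (norm_le_pi_norm (u - v) j))
      _ = (C * R + (C * R + ‖(aeval 0 P : A)‖)) * ‖u - v‖ := by ring

theorem exists_norm_taylorRemainder_sub_le (A : Type*) [NormedCommRing A] [NormedAlgebra 𝕜 A]
    (P : MvPolynomial σ 𝕜) {R : ℝ} (hR : 0 ≤ R) :
    ∃ C : ℝ, 0 ≤ C ∧ ∀ ξ h h' : σ → A, ‖ξ‖ ≤ R → ‖h‖ ≤ R → ‖h'‖ ≤ R →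
      ‖taylorRemainder P ξ h - taylorRemainder P ξ h'‖ ≤ C * (‖h‖ + ‖h'‖) * ‖h - h'‖ := by
  induction P using MvPolynomial.induction_on with
  | C c => exact ⟨0, le_rfl, fun ξ h h' _ _ _ => by simp [taylorRemainder_C]⟩
  | add P Q hP hQ =>
    obtain ⟨C, hC, hP⟩ := hP
    obtain ⟨D, hD, hQ⟩ := hQ
    refine ⟨C + D, by positivity, fun ξ h h' hξ hh hh' => ?_⟩
    rw [taylorRemainder_add, taylorRemainder_add, add_sub_add_comm, add_mul, add_mul]
    exact norm_add_le_of_le (hP ξ h h' hξ hh hh') (hQ ξ h h' hξ hh hh')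
  | mul_X P j hP =>
    obtain ⟨C, hC, hP⟩ := hP
    obtain ⟨D, hD, hlip⟩ := exists_norm_aeval_sub_le A P (add_nonneg hR hR)
    refine ⟨C * R + D, by positivity, fun ξ h h' hξ hh hh' => ?_⟩
    have hξh {k : σ → A} (hk : ‖k‖ ≤ R) : ‖ξ + k‖ ≤ R + R := norm_add_le_of_le hξ hk
    have hsplit : taylorRemainder (P * X j) ξ h - taylorRemainder (P * X j) ξ h' =
        (taylorRemainder P ξ h - taylorRemainder P ξ h') * ξ j +
          (aeval (ξ + h) P - aeval (ξ + h') P) * h j +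
          (aeval (ξ + h') P - aeval ξ P) * (h j - h' j) := by
      rw [taylorRemainder_mul_X, taylorRemainder_mul_X]
      ring
    have hh_lip : ‖aeval (ξ + h) P - aeval (ξ + h') P‖ ≤ D * ‖h - h'‖ := by
      simpa using hlip _ _ (hξh hh) (hξh hh')
    have hh'_lip : ‖aeval (ξ + h') P - aeval ξ P‖ ≤ D * ‖h'‖ := by
      simpa using hlip _ ξ (hξh hh') (hξ.trans (le_add_of_nonneg_right hR))
    rw [hsplit]
    calc _ ≤ C * (‖h‖ + ‖h'‖) * ‖h - h'‖ * R + D * ‖h - h'‖ * ‖h‖ + D * ‖h'‖ * ‖h - h'‖ :=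
          norm_add_le_of_le (norm_add_le_of_le
            (norm_mul_le_of_le (hP ξ h h' hξ hh hh') ((norm_le_pi_norm ξ j).trans hξ))
            (norm_mul_le_of_le hh_lip (norm_le_pi_norm h j)))
            (norm_mul_le_of_le hh'_lip (norm_le_pi_norm (h - h') j))
      _ = (C * R + D) * (‖h‖ + ‖h'‖) * ‖h - h'‖ := by ring

end PolynomialTaylor

/-! ### Absolutely convergent Fourier series with exponential weights -/

section Torus

open BeurlingAlgebra

variable {ι : Type*} [Fintype ι]

/-- The `ℓ¹` length `|k|₁` of a frequency `k`. -/
def freqLength (k : ι → ℤ) : ℝ := ∑ i, |(k i : ℝ)|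

theorem freqLength_nonneg (k : ι → ℤ) : 0 ≤ freqLength k :=
  Finset.sum_nonneg fun _ _ => abs_nonneg _

theorem freqLength_add_le (j k : ι → ℤ) : freqLength (j + k) ≤ freqLength j + freqLength k := by
  simp only [freqLength, ← Finset.sum_add_distrib, Pi.add_apply, Int.cast_add]
  exact Finset.sum_le_sum fun i _ => abs_add_le _ _

variable (ι) in
/-- The weight `e^{a|k|₁}` on the lattice of frequencies. -/
def expWeight (a : NNReal) : BeurlingWeight (ι → ℤ) where
  toFun k := Real.exp (a * freqLength k)
  pos' _ := Real.exp_pos _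
  map_zero' := by simp [freqLength]
  map_add_le' j k := by
    rw [← Real.exp_add, ← mul_add]
    exact Real.exp_le_exp.mpr (mul_le_mul_of_nonneg_left (freqLength_add_le j k) a.2)

theorem expWeight_apply (a : NNReal) (k : ι → ℤ) :
    expWeight ι a k = Real.exp (a * freqLength k) := rfl

theorem one_le_expWeight (a : NNReal) (k : ι → ℤ) : 1 ≤ expWeight ι a k :=
  Real.one_le_exp (mul_nonneg a.2 (freqLength_nonneg k))

variable (ι) in
/-- The Wiener algebra of Fourier series `∑ c_k e^{ik·x}` with `∑ |c_k| e^{a|k|₁} < ∞`. -/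
abbrev Wiener (a : NNReal) := BeurlingAlgebra (expWeight ι a)

/-- The character `k ↦ e^{ik·x}`. -/
def torusChar (x : ι → ℝ) : AddChar (ι → ℤ) ℂ where
  toFun k := Complex.exp (I * ∑ i, (k i : ℂ) * (x i : ℂ))
  map_zero_eq_one' := by simp
  map_add_eq_mul' j k := by
    simp only [Pi.add_apply, Int.cast_add, add_mul, Finset.sum_add_distrib, mul_add,
      Complex.exp_add]

theorem torusChar_apply (x : ι → ℝ) (k : ι → ℤ) :
    torusChar x k = Complex.exp (I * ∑ i, (k i : ℂ) * (x i : ℂ)) := rfl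

/-- The linear form `x ↦ k·x`. -/
def freqForm (k : ι → ℤ) : (ι → ℝ) →L[ℝ] ℝ := ∑ i, (k i : ℝ) • ContinuousLinearMap.proj i

theorem freqForm_apply (k : ι → ℤ) (x : ι → ℝ) : freqForm k x = ∑ i, (k i : ℝ) * x i := by
  simp [freqForm]

theorem norm_freqForm_le (k : ι → ℤ) : ‖freqForm k‖ ≤ freqLength k := by
  refine ContinuousLinearMap.opNorm_le_bound _ (freqLength_nonneg k) fun x => ?_
  rw [freqForm_apply, freqLength, Finset.sum_mul]
  refine norm_sum_le_of_le _ fun i _ => ?_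
  rw [norm_mul, Real.norm_eq_abs]
  exact mul_le_mul_of_nonneg_left (norm_le_pi_norm x i) (abs_nonneg _)

theorem torusChar_eq_exp_freqForm (x : ι → ℝ) (k : ι → ℤ) :
    torusChar x k = Complex.exp (I * freqForm k x) := by
  rw [torusChar_apply, freqForm_apply]
  push_cast
  rfl

theorem norm_torusChar (x : ι → ℝ) (k : ι → ℤ) : ‖torusChar x k‖ = 1 := by
  rw [torusChar_eq_exp_freqForm, mul_comm, norm_exp_ofReal_mul_I]

theorem torusChar_add_two_pi (x : ι → ℝ) (m k : ι → ℤ) :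
    torusChar (fun i => x i + 2 * Real.pi * (m i : ℝ)) k = torusChar x k := by
  have hsum : I * ∑ i, (k i : ℂ) * ((x i + 2 * Real.pi * (m i : ℝ) : ℝ) : ℂ) =
      I * ∑ i, (k i : ℂ) * (x i : ℂ) + ((∑ i, k i * m i : ℤ) : ℂ) * (2 * Real.pi * I) := by
    push_cast
    simp only [mul_add, Finset.sum_add_distrib, Finset.mul_sum, Finset.sum_mul]
    congr 1
    exact Finset.sum_congr rfl fun i _ => by ring
  rw [torusChar_apply, hsum, Complex.exp_add, exp_int_mul_two_pi_mul_I, mul_one, torusChar_apply]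

section Smoothness

theorem hasDerivAt_cexp_I_mul (t : ℝ) :
    HasDerivAt (fun t : ℝ => Complex.exp (I * t)) (I * Complex.exp (I * t)) t := by
  simpa [mul_comm] using ((hasDerivAt_id t).ofReal_comp.const_mul I).cexp

theorem iteratedDeriv_cexp_I_mul (n : ℕ) :
    iteratedDeriv n (fun t : ℝ => Complex.exp (I * t)) =
      fun t : ℝ => I ^ n * Complex.exp (I * t) := by
  induction n with
  | zero => simp
  | succ n ih =>
    rw [iteratedDeriv_succ, ih]
    funext t
    rw [((hasDerivAt_cexp_I_mul t).const_mul (I ^ n)).deriv, pow_succ, mul_assoc]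

theorem contDiff_cexp_I_mul : ContDiff ℝ ∞ fun t : ℝ => Complex.exp (I * t) :=
  (contDiff_const.mul ofRealCLM.contDiff).cexp

theorem contDiff_torusChar (k : ι → ℤ) : ContDiff ℝ ∞ fun x : ι → ℝ => torusChar x k := by
  simp only [torusChar_eq_exp_freqForm]
  exact contDiff_cexp_I_mul.comp (freqForm k).contDiff

theorem hasFDerivAt_torusChar (k : ι → ℤ) (x : ι → ℝ) :
    HasFDerivAt (fun x : ι → ℝ => torusChar x k)
      ((freqForm k).smulRight (I * torusChar x k)) x := by
  simp only [torusChar_eq_exp_freqForm]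
  refine ((hasDerivAt_cexp_I_mul (freqForm k x)).hasFDerivAt.comp x
    (freqForm k).hasFDerivAt).congr_fderiv ?_
  ext v
  simp

theorem norm_iteratedFDeriv_torusChar_le (k : ι → ℤ) (n : ℕ) (x : ι → ℝ) :
    ‖iteratedFDeriv ℝ n (fun x : ι → ℝ => torusChar x k) x‖ ≤ freqLength k ^ n := by
  simp only [torusChar_eq_exp_freqForm]
  change ‖iteratedFDeriv ℝ n ((fun t : ℝ => Complex.exp (I * t)) ∘ freqForm k) x‖ ≤ _
  rw [(freqForm k).iteratedFDeriv_comp_right contDiff_cexp_I_mul x (by exact_mod_cast le_top)]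
  refine (ContinuousMultilinearMap.norm_compContinuousLinearMap_le _ _).trans ?_
  rw [norm_iteratedFDeriv_eq_norm_iteratedDeriv, iteratedDeriv_cexp_I_mul, norm_mul, norm_pow,
    norm_I, one_pow, one_mul, mul_comm I, norm_exp_ofReal_mul_I, one_mul, Finset.prod_const,
    Finset.card_univ, Fintype.card_fin]
  exact pow_le_pow_left₀ (norm_nonneg _) (norm_freqForm_le k) n

end Smoothness

theorem exists_one_add_pow_le_mul_exp {b : ℝ} (hb : 0 < b) (n : ℕ) :
    ∃ C : ℝ, 0 ≤ C ∧ ∀ t : ℝ, 0 ≤ t → (1 + t) ^ n ≤ C * Real.exp (b * t) := by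
  refine ⟨n.factorial * Real.exp b / b ^ n, by positivity, fun t ht => ?_⟩
  have h := Real.pow_div_factorial_le_exp (b * (1 + t)) (by positivity) n
  rw [div_le_iff₀ (by positivity), mul_pow, mul_add, Real.exp_add, mul_one] at h
  rw [div_mul_eq_mul_div, le_div_iff₀ (by positivity)]
  linarith

namespace Wiener

variable {a : NNReal}

/-- The value at `x` of the function `∑ c_k e^{ik·x}` represented by an element of the Wiener
algebra. -/
def eval (x : ι → ℝ) : Wiener ι a →ₐ[ℂ] ℂ :=
  evalChar (torusChar x) fun k => (norm_torusChar x k).trans_le (one_le_expWeight a k)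

theorem hasSum_eval (f : Wiener ι a) (x : ι → ℝ) :
    HasSum (fun k => coeff k f * torusChar x k) (eval x f) := hasSum_evalChar _ _ f

theorem eval_mode (x : ι → ℝ) (k : ι → ℤ) : eval x (mode k : Wiener ι a) = torusChar x k :=
  evalChar_mode _ _ k

theorem eval_eq_tsum (f : Wiener ι a) :
    (fun x => eval x f) = fun x => ∑' k, coeff k f * torusChar x k :=
  funext fun x => (hasSum_eval f x).tsum_eq.symm

theorem eval_add_two_pi (f : Wiener ι a) (m : ι → ℤ) (x : ι → ℝ) :
    eval (fun i => x i + 2 * Real.pi * (m i : ℝ)) f = eval x f := by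
  rw [← (hasSum_eval f _).tsum_eq, ← (hasSum_eval f x).tsum_eq]
  simp only [torusChar_add_two_pi]

theorem summable_norm_coeff_mul_freqLength_pow (ha : 0 < a) (f : Wiener ι a) (n : ℕ) :
    Summable fun k => ‖coeff k f‖ * freqLength k ^ n := by
  obtain ⟨C, -, hC⟩ := exists_one_add_pow_le_mul_exp (NNReal.coe_pos.mpr ha) n
  refine Summable.of_nonneg_of_le
    (fun k => mul_nonneg (norm_nonneg _) (pow_nonneg (freqLength_nonneg k) n)) (fun k => ?_)
    ((hasSum_norm_coeff_mul f).summable.mul_left C)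
  rw [mul_left_comm]
  have hk := freqLength_nonneg k
  exact mul_le_mul_of_nonneg_left
    ((pow_le_pow_left₀ hk (le_add_of_nonneg_left zero_le_one) n).trans (hC _ hk)) (norm_nonneg _)

theorem contDiff_eval (ha : 0 < a) (f : Wiener ι a) : ContDiff ℝ ∞ fun x => eval x f := by
  rw [eval_eq_tsum]
  refine contDiff_tsum (N := ⊤) (v := fun n k => ‖coeff k f‖ * freqLength k ^ n)
    (fun k => contDiff_const.mul (contDiff_torusChar k))
    (fun n _ => summable_norm_coeff_mul_freqLength_pow ha f n) fun n k x _ => ?_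
  have hsmul : iteratedFDeriv ℝ n (fun x => coeff k f * torusChar x k) x =
      coeff k f • iteratedFDeriv ℝ n (fun x => torusChar x k) x :=
    iteratedFDeriv_const_smul_apply (a := coeff k f) (f := fun x => torusChar x k)
      ((contDiff_torusChar k).of_le (by exact_mod_cast le_top)).contDiffAt
  rw [hsmul, norm_smul]
  exact mul_le_mul_of_nonneg_left (norm_iteratedFDeriv_torusChar_le k n x) (norm_nonneg _)

theorem fderiv_eval_single [DecidableEq ι] (ha : 0 < a) {f g : Wiener ι a} {i : ι}
    (hfg : ∀ k, coeff k g = I * k i * coeff k f) (x : ι → ℝ) :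
    fderiv ℝ (fun x => eval x f) x (Pi.single i 1) = eval x g := by
  have hsum := summable_norm_coeff_mul_freqLength_pow ha f 1
  have hderiv (k : ι → ℤ) (x : ι → ℝ) : HasFDerivAt (fun x => coeff k f * torusChar x k)
      (coeff k f • (freqForm k).smulRight (I * torusChar x k)) x :=
    (hasFDerivAt_torusChar k x).const_mul (coeff k f)
  have hbound (k : ι → ℤ) (x : ι → ℝ) :
      ‖coeff k f • (freqForm k).smulRight (I * torusChar x k)‖ ≤
        ‖coeff k f‖ * freqLength k ^ 1 := by
    rw [norm_smul, ContinuousLinearMap.norm_smulRight_apply, norm_mul, norm_torusChar, norm_I,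
      mul_one, mul_one, pow_one]
    exact mul_le_mul_of_nonneg_left (norm_freqForm_le k) (norm_nonneg _)
  rw [eval_eq_tsum,
    (hasFDerivAt_tsum hsum hderiv hbound (hasSum_eval f x).summable x).fderiv]
  refine ((Summable.of_norm_bounded hsum fun k => hbound k x).hasSum.mapL
    (ContinuousLinearMap.apply ℝ ℂ (Pi.single i 1 : ι → ℝ))).unique ?_
  refine (hasSum_eval g x).congr_fun fun k => ?_
  rw [hfg]
  simp [freqForm_apply, Pi.single_apply]
  ring

theorem torusPeriodic_eval (f : Wiener (Fin 2) a) : TorusPeriodic fun x => eval x f :=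
  fun k x => eval_add_two_pi f k x

end Wiener

end Torus

/-! ### Fourier coefficients of functions holomorphic on a strip -/

section Circle

/-- The Fourier coefficient `(2π)⁻¹ ∫₀^{2π} e^{-ikx} g(x) dx`. -/
def circleCoeff (g : ℝ → ℂ) (k : ℤ) : ℂ :=
  (2 * Real.pi : ℂ)⁻¹ * ∫ x in (0 : ℝ)..2 * Real.pi, Complex.exp (-(I * (k * x))) * g x

theorem norm_cexp_I_mul_intCast_mul (k : ℤ) (x : ℝ) : ‖Complex.exp (I * (k * x))‖ = 1 := by
  rw [mul_comm, ← ofReal_intCast, ← ofReal_mul, norm_exp_ofReal_mul_I]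

theorem norm_circleCoeff_le {g : ℝ → ℂ} {B : ℝ} (hB : ∀ x, ‖g x‖ ≤ B) (k : ℤ) :
    ‖circleCoeff g k‖ ≤ B := by
  have hintegral : ‖∫ x in (0 : ℝ)..2 * Real.pi, Complex.exp (-(I * (k * x))) * g x‖ ≤
      B * |2 * Real.pi - 0| := intervalIntegral.norm_integral_le_of_norm_le_const fun x _ => by
    rw [norm_mul, Complex.exp_neg, norm_inv, norm_cexp_I_mul_intCast_mul, inv_one, one_mul]
    exact hB x
  have hpi := Real.two_pi_pos
  rw [sub_zero, abs_of_pos hpi] at hintegral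
  rw [circleCoeff, norm_mul, ← ofReal_ofNat, ← ofReal_mul, norm_inv, norm_real,
    Real.norm_of_nonneg hpi.le,
    inv_mul_le_iff₀ hpi, mul_comm _ B]
  exact hintegral

theorem hasSum_circleCoeff {g : ℝ → ℂ} (hg : Continuous g)
    (hper : Function.Periodic g (2 * Real.pi)) (hs : Summable fun k => ‖circleCoeff g k‖) (x : ℝ) :
    HasSum (fun k : ℤ => circleCoeff g k * Complex.exp (I * (k * x))) (g x) := by
  have : Fact (0 < 2 * Real.pi) := ⟨Real.two_pi_pos⟩
  have hpi : (Real.pi : ℂ) ≠ 0 := ofReal_ne_zero.mpr Real.pi_ne_zero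
  let G : C(AddCircle (2 * Real.pi), ℂ) := ⟨hper.lift, hg.quotient_liftOn' _⟩
  have hchar (k : ℤ) (y : ℝ) :
      fourier k (y : AddCircle (2 * Real.pi)) = Complex.exp (I * (k * y)) := by
    rw [fourier_coe_apply]
    congr 1
    push_cast
    field_simp
  have hcoeff (k : ℤ) : fourierCoeff G k = circleCoeff g k := by
    rw [fourierCoeff_eq_intervalIntegral _ _ 0, zero_add, circleCoeff, real_smul, one_div]
    simp only [hchar, smul_eq_mul, Int.cast_neg, neg_mul, mul_neg, ofReal_inv, ofReal_mul,
      ofReal_ofNat]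
    rfl
  have h := has_pointwise_sum_fourier_series_of_summable
    (Summable.of_norm (hs.congr fun k => by rw [hcoeff])) (x : AddCircle (2 * Real.pi))
  have hx : G x = g x := hper.lift_coe x
  simpa only [hcoeff, hchar, smul_eq_mul, hx] using h

theorem continuous_circleCoeff {X : Type*} [TopologicalSpace X] {F : X → ℝ → ℂ}
    (hF : Continuous (Function.uncurry F)) (k : ℤ) : Continuous fun p => circleCoeff (F p) k := by
  refine continuous_const.mul
    (intervalIntegral.continuous_parametric_intervalIntegral_of_continuous' (f := fun p (x : ℝ) =>
      Complex.exp (-(I * (k * x))) * F p x) ?_ _ _)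
  exact Continuous.mul (by fun_prop) hF

theorem circleCoeff_const_mul (c : ℂ) (g : ℝ → ℂ) (k : ℤ) :
    circleCoeff (fun x => c * g x) k = c * circleCoeff g k := by
  simp only [circleCoeff, mul_left_comm _ c, intervalIntegral.integral_const_mul]

variable {h : ℂ → ℂ} {κ t : ℝ}

theorem integral_eq_integral_add_mul_I (hd : DifferentiableOn ℂ h {z | |z.im| < κ})
    (hper : ∀ z : ℂ, |z.im| < κ → h (z + 2 * Real.pi) = h z) (ht : |t| < κ) :
    ∫ x in (0 : ℝ)..2 * Real.pi, h x = ∫ x in (0 : ℝ)..2 * Real.pi, h (x + t * I) := by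
  have him {y : ℝ} (hy : y ∈ Set.uIcc 0 t) : |y| < κ := by
    simpa using (Set.abs_sub_left_of_mem_uIcc hy).trans_lt (by simpa using ht)
  have hsides :
      ∫ y in (0 : ℝ)..t, h ((2 * Real.pi : ℝ) + y * I) = ∫ y in (0 : ℝ)..t, h (y * I) := by
    refine intervalIntegral.integral_congr fun y hy => ?_
    have h2pi := hper (y * I) (by simpa using him hy)
    rw [add_comm] at h2pi
    simpa using h2pi
  have hrect := Complex.integral_boundary_rect_eq_zero_of_differentiableOn h 0
    ((2 * Real.pi : ℝ) + t * I) (hd.mono fun z hz => him (by simpa using hz.2))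
  simp only [zero_re, zero_im, add_re, add_im, mul_re, mul_im, ofReal_re, ofReal_im, I_re, I_im,
    mul_zero, mul_one, sub_zero, zero_add, add_zero, ofReal_zero, zero_mul] at hrect
  rwa [hsides, add_sub_assoc, sub_self, add_zero, sub_eq_zero] at hrect

theorem circleCoeff_eq_exp_mul (hd : DifferentiableOn ℂ h {z | |z.im| < κ})
    (hper : ∀ z : ℂ, |z.im| < κ → h (z + 2 * Real.pi) = h z) (ht : |t| < κ) (k : ℤ) :
    circleCoeff (fun x => h x) k =
      (Real.exp (k * t) : ℂ) * circleCoeff (fun x => h (x + t * I)) k := by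
  have hchar (z : ℂ) : Complex.exp (-(I * (k * (z + 2 * Real.pi)))) =
      Complex.exp (-(I * (k * z))) := by
    have : -(I * (k * (z + 2 * Real.pi))) =
        -(I * (k * z)) + ((-k : ℤ) : ℂ) * (2 * Real.pi * I) := by
      push_cast
      ring
    rw [this, Complex.exp_add, exp_int_mul_two_pi_mul_I, mul_one]
  have hexp : Differentiable ℂ fun z : ℂ => Complex.exp (-(I * (k * z))) := by fun_prop
  have hshift := integral_eq_integral_add_mul_I (h := fun z => Complex.exp (-(I * (k * z))) * h z)
    (hexp.differentiableOn.mul hd) (fun z hz => by rw [hper z hz, hchar]) ht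
  rw [circleCoeff, hshift, circleCoeff, mul_left_comm]
  simp only [← intervalIntegral.integral_const_mul]
  refine intervalIntegral.integral_congr fun x _ => ?_
  have hphase : Complex.exp (-(I * (k * (x + t * I)))) =
      (Real.exp (k * t) : ℂ) * Complex.exp (-(I * (k * x))) := by
    rw [ofReal_exp, ← Complex.exp_add]
    congr 1
    push_cast
    linear_combination (-(k : ℂ) * t) * I_sq
  simp only [hphase]
  ring

end Circle

section TorusCoefficients

theorem setIntegral_Icc_fin_two {E : Type*} [NormedAddCommGroup E] [NormedSpace ℝ E]
    {u : (Fin 2 → ℝ) → E} (hu : Continuous u) {a b : Fin 2 → ℝ} (hab : a ≤ b) :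
    ∫ x in Set.Icc a b, u x = ∫ x in a 0..b 0, ∫ y in a 1..b 1, u ![x, y] := by
  have hpre : Set.Icc a b =
      MeasurableEquiv.finTwoArrow ⁻¹' (Set.Icc (a 0) (b 0) ×ˢ Set.Icc (a 1) (b 1)) := by
    ext x
    simp only [Set.mem_Icc, Pi.le_def, Fin.forall_fin_two, Set.mem_preimage, Set.mem_prod]
    exact and_and_and_comm
  have huncurry : Continuous fun p : ℝ × ℝ => u ![p.1, p.2] := by fun_prop
  have h := (volume_preserving_finTwoArrow ℝ).setIntegral_preimage_emb
    MeasurableEquiv.finTwoArrow.measurableEmbedding (fun p : ℝ × ℝ => u ![p.1, p.2])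
    (Set.Icc (a 0) (b 0) ×ˢ Set.Icc (a 1) (b 1))
  rw [← hpre] at h
  have hx (x : Fin 2 → ℝ) :
      ![(MeasurableEquiv.finTwoArrow x).1, (MeasurableEquiv.finTwoArrow x).2] = x := by
    ext i
    fin_cases i <;> rfl
  simp only [hx] at h
  rw [h, Measure.volume_eq_prod, setIntegral_prod _
    (huncurry.continuousOn.integrableOn_compact (isCompact_Icc.prod isCompact_Icc)),
    integral_Icc_eq_integral_Ioc, ← intervalIntegral.integral_of_le (hab 0)]
  simp only [integral_Icc_eq_integral_Ioc, ← intervalIntegral.integral_of_le (hab 1)]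

variable {u : (Fin 2 → ℝ) → ℂ}

theorem fourierCoeffTorus_eq_circleCoeff (hu : Continuous u) (k : Fin 2 → ℤ) :
    fourierCoeffTorus u k =
      circleCoeff (fun x => circleCoeff (fun y => u ![x, y]) (k 1)) (k 0) := by
  rw [fourierCoeffTorus, setIntegral_Icc_fin_two (a := 0) (b := fun _ => 2 * Real.pi) (by fun_prop)
    fun _ => Real.two_pi_pos.le]
  simp only [circleCoeff, ← intervalIntegral.integral_const_mul]
  refine intervalIntegral.integral_congr fun x _ => intervalIntegral.integral_congr fun y _ => ?_
  simp only [Fin.sum_univ_two, Matrix.cons_val_zero, Matrix.cons_val_one, mul_add, neg_add,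
    Complex.exp_add]
  ring

theorem fourierCoeffTorus_eq_circleCoeff_swap (hu : Continuous u) (k : Fin 2 → ℤ) :
    fourierCoeffTorus u k =
      circleCoeff (fun y => circleCoeff (fun x => u ![x, y]) (k 0)) (k 1) := by
  rw [fourierCoeffTorus_eq_circleCoeff hu]
  simp only [circleCoeff, ← intervalIntegral.integral_const_mul]
  rw [intervalIntegral_intervalIntegral_swap]
  · simp only [mul_left_comm]
  · exact (Continuous.continuousOn (by fun_prop)).integrableOn_compact
      (isCompact_uIcc.prod isCompact_uIcc) |>.mono_set
      (Set.prod_mono Set.uIoc_subset_uIcc Set.uIoc_subset_uIcc)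

theorem continuous_fourierCoeffTorus {X : Type*} [TopologicalSpace X] {F : X → (Fin 2 → ℝ) → ℂ}
    (hF : Continuous (Function.uncurry F)) (k : Fin 2 → ℤ) :
    Continuous fun p => fourierCoeffTorus (F p) k := by
  have hslice (p : X) : Continuous (F p) := by fun_prop
  simp only [fourierCoeffTorus_eq_circleCoeff (hslice _)]
  refine continuous_circleCoeff (F := fun p x => circleCoeff (fun y => F p ![x, y]) (k 1)) ?_ _
  exact continuous_circleCoeff (F := fun (q : X × ℝ) y => F q.1 ![q.2, y]) (by fun_prop) _

theorem norm_fourierCoeffTorus_le (hu : Continuous u) {B : ℝ} (hB : ∀ x, ‖u x‖ ≤ B)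
    (k : Fin 2 → ℤ) : ‖fourierCoeffTorus u k‖ ≤ B := by
  rw [fourierCoeffTorus_eq_circleCoeff hu]
  exact norm_circleCoeff_le (fun x => norm_circleCoeff_le (fun y => hB _) _) _

theorem TorusPeriodic.periodic_fst (hper : TorusPeriodic u) (y : ℝ) :
    Function.Periodic (fun x => u ![x, y]) (2 * Real.pi) := fun x => by
  refine (congrArg u ?_).trans (hper ![1, 0] ![x, y])
  ext i
  fin_cases i <;> simp

theorem TorusPeriodic.periodic_snd (hper : TorusPeriodic u) (x : ℝ) :
    Function.Periodic (fun y => u ![x, y]) (2 * Real.pi) := fun y => by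
  refine (congrArg u ?_).trans (hper ![0, 1] ![x, y])
  ext i
  fin_cases i <;> simp

theorem hasSum_fourierCoeffTorus_fst (hu : Continuous u) (hper : TorusPeriodic u) (l : ℤ)
    (hs : Summable fun k : ℤ => ‖fourierCoeffTorus u ![k, l]‖) (x : ℝ) :
    HasSum (fun k : ℤ => fourierCoeffTorus u ![k, l] * Complex.exp (I * (k * x)))
      (circleCoeff (fun y => u ![x, y]) l) := by
  simp only [fourierCoeffTorus_eq_circleCoeff hu, Matrix.cons_val_zero, Matrix.cons_val_one]
    at hs ⊢
  refine hasSum_circleCoeff (g := fun x => circleCoeff (fun y => u ![x, y]) l)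
    (continuous_circleCoeff (F := fun x y => u ![x, y]) (by fun_prop) l)
    (fun x => congrArg (circleCoeff · l) (funext fun y => hper.periodic_fst y x)) hs x

theorem hasSum_fourierCoeffTorus (hu : Continuous u) (hper : TorusPeriodic u)
    (hs : Summable fun k => ‖fourierCoeffTorus u k‖) (x : Fin 2 → ℝ) :
    HasSum (fun k => fourierCoeffTorus u k * torusChar x k) (u x) := by
  let e : ℤ × ℤ ≃ (Fin 2 → ℤ) := (Equiv.prodComm ℤ ℤ).trans (finTwoArrowEquiv ℤ).symm
  have hs_prod : Summable fun p => ‖fourierCoeffTorus u (e p)‖ := e.summable_iff.mpr hs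
  have hinner (l : ℤ) := hasSum_fourierCoeffTorus_fst hu hper l (hs_prod.prod_factor l) (x 0)
  have hnorm (l : ℤ) : (fun k : ℤ => ‖fourierCoeffTorus u ![k, l] * Complex.exp (I * (k * x 0))‖) =
      fun k : ℤ => ‖fourierCoeffTorus u ![k, l]‖ := by
    funext k
    rw [norm_mul, norm_cexp_I_mul_intCast_mul, mul_one]
  have hinner_norm (l : ℤ) : ‖circleCoeff (fun y => u ![x 0, y]) l‖ ≤
      ∑' k, ‖fourierCoeffTorus u (e (l, k))‖ := by
    have h := norm_tsum_le_tsum_norm ((hnorm l).symm ▸ hs_prod.prod_factor l)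
    rwa [(hinner l).tsum_eq, hnorm] at h
  have houter : HasSum (fun l : ℤ => circleCoeff (fun y => u ![x 0, y]) l *
      Complex.exp (I * (l * x 1))) (u ![x 0, x 1]) :=
    hasSum_circleCoeff (g := fun y => u ![x 0, y]) (by fun_prop) (hper.periodic_snd _)
      (.of_nonneg_of_le (fun _ => norm_nonneg _) hinner_norm hs_prod.prod) _
  have hs_char : Summable fun p => fourierCoeffTorus u (e p) * torusChar x (e p) := by
    refine Summable.of_norm (hs_prod.congr fun p => ?_)
    rw [norm_mul, norm_torusChar, mul_one]
  have hx : ![x 0, x 1] = x := by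
    ext i
    fin_cases i <;> rfl
  rw [hx] at houter
  rw [← e.hasSum_iff]
  refine (hs_char.hasSum.prod_fiberwise fun l => ?_).unique houter ▸ hs_char.hasSum
  refine ((hinner l).mul_right (Complex.exp (I * (l * x 1)))).congr_fun fun k => ?_
  rw [mul_assoc, ← Complex.exp_add, torusChar_apply, Fin.sum_univ_two, mul_add]
  rfl

end TorusCoefficients

section Strip

/-- A holomorphic function on `|Im z_j| < κ` which is `(2πℤ)²`-periodic. -/
structure HolomorphicOnStrip (κ : ℝ) (h : (Fin 2 → ℂ) → ℂ) : Prop where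
  differentiableOn : DifferentiableOn ℂ h {z | ∀ i, |(z i).im| < κ}
  periodic : ∀ z : Fin 2 → ℂ, (∀ i, |(z i).im| < κ) → ∀ k : Fin 2 → ℤ,
    h (fun i => z i + 2 * Real.pi * (k i : ℂ)) = h z

namespace HolomorphicOnStrip

variable {κ : ℝ} {h : (Fin 2 → ℂ) → ℂ}

theorem continuous_shift (hh : HolomorphicOnStrip κ h) {t : Fin 2 → ℝ} (ht : ∀ i, |t i| < κ) :
    Continuous fun x : Fin 2 → ℝ => h fun i => x i + t i * I :=
  hh.differentiableOn.continuousOn.comp_continuous (by fun_prop) fun x i => by simpa using ht i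

theorem torusPeriodic (hh : HolomorphicOnStrip κ h) (hκ : 0 < κ) :
    TorusPeriodic fun x => h fun i => (x i : ℂ) := fun k x => by
  simpa using hh.periodic (fun i => x i) (fun i => by simpa using hκ) k

theorem circleCoeff_fst (hh : HolomorphicOnStrip κ h) {t : ℝ} (ht : |t| < κ) {w : ℂ}
    (hw : |w.im| < κ) (k : ℤ) :
    circleCoeff (fun x => h ![(x : ℂ), w]) k =
      (Real.exp (k * t) : ℂ) * circleCoeff (fun x => h ![x + t * I, w]) k := by
  refine circleCoeff_eq_exp_mul (h := fun z => h ![z, w]) (hh.differentiableOn.comp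
    (differentiableOn_pi.mpr (Fin.forall_fin_two.mpr ⟨differentiableOn_id,
      differentiableOn_const w⟩))
    fun z hz => Fin.forall_fin_two.mpr ⟨hz, hw⟩) (fun z hz => ?_) ht k
  refine (congrArg h ?_).trans (hh.periodic ![z, w] (Fin.forall_fin_two.mpr ⟨hz, hw⟩) ![1, 0])
  ext i
  fin_cases i <;> simp

theorem circleCoeff_snd (hh : HolomorphicOnStrip κ h) {t : ℝ} (ht : |t| < κ) {z : ℂ}
    (hz : |z.im| < κ) (k : ℤ) :
    circleCoeff (fun y => h ![z, (y : ℂ)]) k =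
      (Real.exp (k * t) : ℂ) * circleCoeff (fun y => h ![z, y + t * I]) k := by
  refine circleCoeff_eq_exp_mul (h := fun w => h ![z, w]) (hh.differentiableOn.comp
    (differentiableOn_pi.mpr (Fin.forall_fin_two.mpr ⟨differentiableOn_const z,
      differentiableOn_id⟩))
    fun w hw => Fin.forall_fin_two.mpr ⟨hz, hw⟩) (fun w hw => ?_) ht k
  refine (congrArg h ?_).trans (hh.periodic ![z, w] (Fin.forall_fin_two.mpr ⟨hz, hw⟩) ![0, 1])
  ext i
  fin_cases i <;> simp

theorem fourierCoeffTorus_eq_exp_mul (hh : HolomorphicOnStrip κ h) {t : Fin 2 → ℝ}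
    (ht : ∀ i, |t i| < κ) (k : Fin 2 → ℤ) :
    fourierCoeffTorus (fun x => h fun i => (x i : ℂ)) k =
      (Real.exp (∑ i, k i * t i) : ℂ) *
        fourierCoeffTorus (fun x => h fun i => x i + t i * I) k := by
  have hκ : 0 < κ := (abs_nonneg _).trans_lt (ht 0)
  have hcons (x y : ℝ) (s : Fin 2 → ℝ) :
      (fun i => (![x, y] i : ℂ) + s i * I) = ![x + s 0 * I, y + s 1 * I] := by
    ext i
    fin_cases i <;> rfl
  have hcont := hh.continuous_shift ht
  have hcont₁ := hh.continuous_shift (t := ![0, t 1]) (Fin.forall_fin_two.mpr ⟨by simpa, ht 1⟩)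
  have hcont₀ := hh.continuous_shift (t := 0) (by simpa)
  have hshift_snd : fourierCoeffTorus (fun x => h fun i => x i + (0 : Fin 2 → ℝ) i * I) k =
      (Real.exp (k 1 * t 1) : ℂ) *
        fourierCoeffTorus (fun x => h fun i => x i + (![0, t 1] i : ℝ) * I) k := by
    rw [fourierCoeffTorus_eq_circleCoeff hcont₀, fourierCoeffTorus_eq_circleCoeff hcont₁]
    simp only [hcons, ← circleCoeff_const_mul]
    simp [hh.circleCoeff_snd (ht 1) (z := (_ : ℝ)) (by simpa), ← circleCoeff_const_mul]
  have hshift_fst : fourierCoeffTorus (fun x => h fun i => x i + (![0, t 1] i : ℝ) * I) k =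
      (Real.exp (k 0 * t 0) : ℂ) *
        fourierCoeffTorus (fun x => h fun i => x i + t i * I) k := by
    rw [fourierCoeffTorus_eq_circleCoeff_swap hcont₁, fourierCoeffTorus_eq_circleCoeff_swap hcont]
    simp only [hcons, ← circleCoeff_const_mul]
    simp [hh.circleCoeff_fst (ht 0) (w := (_ : ℝ) + t 1 * I) (by simpa using ht 1),
      ← circleCoeff_const_mul]
  rw [hshift_fst, ← mul_assoc, ← ofReal_mul, ← Real.exp_add, add_comm, ← Fin.sum_univ_two
    fun i => k i * t i] at hshift_snd
  simpa using hshift_snd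

theorem norm_fourierCoeffTorus_le_exp (hh : HolomorphicOnStrip κ h) {B b : ℝ}
    (hB : ∀ z : Fin 2 → ℂ, (∀ i, |(z i).im| < κ) → ‖h z‖ ≤ B) (hb : 0 ≤ b) (hbκ : b < κ)
    (k : Fin 2 → ℤ) :
    ‖fourierCoeffTorus (fun x => h fun i => (x i : ℂ)) k‖ ≤
      B * Real.exp (-(b * freqLength k)) := by
  let t : Fin 2 → ℝ := fun i => -(b * ((k i).sign : ℝ))
  have ht (i) : |t i| < κ := by
    rcases lt_trichotomy (k i) 0 with hk | hk | hk <;>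
      simp [t, hk, Int.sign_eq_neg_one_of_neg, Int.sign_eq_one_of_pos,
        abs_of_nonneg hb, hb.trans_lt hbκ, hbκ]
  have hkt : ∑ i, k i * t i = -(b * freqLength k) := by
    simp only [t, freqLength, Finset.mul_sum, ← Finset.sum_neg_distrib]
    refine Finset.sum_congr rfl fun i _ => ?_
    rw [← Int.cast_abs, ← Int.sign_mul_self_eq_abs]
    push_cast
    ring
  rw [hh.fourierCoeffTorus_eq_exp_mul ht, norm_mul, norm_real, Real.norm_of_nonneg
    (Real.exp_pos _).le, hkt, mul_comm B]
  exact mul_le_mul_of_nonneg_left (norm_fourierCoeffTorus_le (hh.continuous_shift ht)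
    (fun x => hB _ fun i => by simpa using ht i) k) (Real.exp_pos _).le

end HolomorphicOnStrip

end Strip

/-! ### Composition with a holomorphic symbol -/

section Composition

open BeurlingAlgebra

theorem summable_exp_neg_mul_abs {b : ℝ} (hb : 0 < b) :
    Summable fun n : ℤ => Real.exp (-(b * |(n : ℝ)|)) := by
  have hgeom : Summable fun n : ℕ => Real.exp (-(b * n)) := by
    refine (summable_geometric_of_lt_one (Real.exp_pos (-b)).le
      (Real.exp_lt_one_iff.mpr (neg_lt_zero.mpr hb))).congr fun n => ?_
    rw [← Real.exp_nat_mul]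
    congr 1
    ring
  rw [summable_int_iff_summable_nat_and_neg]
  constructor <;> simpa using hgeom

theorem summable_exp_neg_mul_freqLength {b : ℝ} (hb : 0 < b) :
    Summable fun k : Fin 2 → ℤ => Real.exp (-(b * freqLength k)) := by
  have h := summable_exp_neg_mul_abs hb
  rw [← (finTwoArrowEquiv ℤ).symm.summable_iff]
  refine (h.mul_of_nonneg h (fun _ => (Real.exp_pos _).le) fun _ => (Real.exp_pos _).le).congr
    fun p => ?_
  rw [Function.comp_apply, ← Real.exp_add, ← neg_add, ← mul_add, freqLength, Fin.sum_univ_two]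
  rfl

/-- The sum `∑ e^{-a|k|₁}`, which bounds the norm of a Fourier series in the Wiener algebra by the
supremum of its sum on a wider strip. -/
def decaySum (a : NNReal) : ℝ := ∑' k : Fin 2 → ℤ, Real.exp (-(a * freqLength k))

theorem decaySum_nonneg (a : NNReal) : 0 ≤ decaySum a := tsum_nonneg fun _ => (Real.exp_pos _).le

namespace Wiener

/-- The element of the Wiener algebra with the Fourier coefficients of `u`, provided that these
decay fast enough. -/
def ofFunction (a : NNReal) (u : (Fin 2 → ℝ) → ℂ) : Wiener (Fin 2) a :=
  ∑' k, fourierCoeffTorus u k • mode k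

variable {a : NNReal} {u : (Fin 2 → ℝ) → ℂ} {B : ℝ}

theorem norm_fourierCoeffTorus_smul_mode_le {k : Fin 2 → ℤ}
    (hu : ‖fourierCoeffTorus u k‖ ≤ B * Real.exp (-(2 * a * freqLength k))) :
    ‖fourierCoeffTorus u k • (mode k : Wiener (Fin 2) a)‖ ≤
      B * Real.exp (-(a * freqLength k)) := by
  rw [norm_smul, norm_mode, expWeight_apply]
  refine (mul_le_mul_of_nonneg_right hu (Real.exp_pos _).le).trans_eq ?_
  rw [mul_assoc, ← Real.exp_add]
  congr 2
  ring

theorem summable_norm_fourierCoeffTorus_smul_mode (ha : 0 < a)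
    (hu : ∀ k, ‖fourierCoeffTorus u k‖ ≤ B * Real.exp (-(2 * a * freqLength k))) :
    Summable fun k => ‖fourierCoeffTorus u k • (mode k : Wiener (Fin 2) a)‖ :=
  .of_nonneg_of_le (fun _ => norm_nonneg _)
    (fun k => norm_fourierCoeffTorus_smul_mode_le (hu k))
    ((summable_exp_neg_mul_freqLength (NNReal.coe_pos.mpr ha)).mul_left B)

theorem norm_ofFunction_le (ha : 0 < a)
    (hu : ∀ k, ‖fourierCoeffTorus u k‖ ≤ B * Real.exp (-(2 * a * freqLength k))) :
    ‖ofFunction a u‖ ≤ decaySum a * B := by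
  have hs := summable_norm_fourierCoeffTorus_smul_mode ha hu
  refine (norm_tsum_le_tsum_norm hs).trans ?_
  rw [mul_comm, decaySum, ← tsum_mul_left]
  exact hs.tsum_le_tsum (fun k => norm_fourierCoeffTorus_smul_mode_le (hu k))
    ((summable_exp_neg_mul_freqLength (NNReal.coe_pos.mpr ha)).mul_left B)

theorem eval_ofFunction (ha : 0 < a)
    (hu : ∀ k, ‖fourierCoeffTorus u k‖ ≤ B * Real.exp (-(2 * a * freqLength k)))
    (hcont : Continuous u) (hper : TorusPeriodic u) (x : Fin 2 → ℝ) :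
    eval x (ofFunction a u) = u x := by
  have hs := (summable_norm_fourierCoeffTorus_smul_mode ha hu).of_norm.hasSum
  have hcoeff (k : Fin 2 → ℤ) : coeff k (ofFunction a u) = fourierCoeffTorus u k := by
    refine (hs.mapL (coeff k)).unique ?_
    convert hasSum_single k fun j hj => ?_ using 1
    · rw [map_smul, coeff_mode_self, smul_eq_mul, mul_one]
    · rw [map_smul, coeff_mode_of_ne hj.symm, smul_zero]
  have hsum : Summable fun k => ‖fourierCoeffTorus u k‖ :=
    .of_nonneg_of_le (fun _ => norm_nonneg _) hu
      ((summable_exp_neg_mul_freqLength (mul_pos two_pos (NNReal.coe_pos.mpr ha))).mul_left B)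
  refine (hasSum_eval _ x).unique ?_
  simpa only [hcoeff] using hasSum_fourierCoeffTorus hcont hper hsum x

end Wiener

theorem differentiable_add_smul_vec (ξ : Fin 2 → ℂ) (c : ℂ) {g₀ g₁ : ℂ → ℂ}
    (h₀ : Differentiable ℂ g₀) (h₁ : Differentiable ℂ g₁) :
    Differentiable ℂ fun z => ξ + c • ![g₀ z, g₁ z] :=
  ((differentiable_pi.mpr (Fin.forall_fin_two.mpr ⟨h₀, h₁⟩)).const_smul c).const_add ξ

/-- A symbol `f(x, ζ)` which is holomorphic on `|Im x_j| < κ`, `|ζ| < κ` and `(2πℤ)²`-periodic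
in `x`. -/
structure IsPeriodicSymbol (κ : ℝ) (f : (Fin 2 → ℂ) → (Fin 2 → ℂ) → ℂ) : Prop where
  differentiableOn : DifferentiableOn ℂ (fun z : (Fin 2 → ℂ) × (Fin 2 → ℂ) => f z.1 z.2)
    (complexNhd κ)
  periodic : ∀ x ζ, (x, ζ) ∈ complexNhd κ → ∀ k : Fin 2 → ℤ,
    f (fun i => x i + 2 * Real.pi * (k i : ℂ)) ζ = f x ζ

/-- The Fourier series of `x ↦ f(x, ξ + e(z, w))`. -/
def symbolSeries (a : NNReal) (f : (Fin 2 → ℂ) → (Fin 2 → ℂ) → ℂ) (ξ : Fin 2 → ℂ) (e : ℝ)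
    (z w : ℂ) : Wiener (Fin 2) a :=
  Wiener.ofFunction a fun x => f (fun i => x i) (ξ + (e : ℂ) • ![z, w])

/-- The composition `f(x, ξ + e v(x))` in the Wiener algebra, given by Cauchy's formula on the unit
bidisc. -/
def composition (a : NNReal) (f : (Fin 2 → ℂ) → (Fin 2 → ℂ) → ℂ) (ξ : Fin 2 → ℂ) (e : ℝ)
    (v : Fin 2 → Wiener (Fin 2) a) : Wiener (Fin 2) a :=
  cauchyCalc₂ (symbolSeries a f ξ e) v

theorem ofReal_mem_complexNhd {κ : ℝ} (x : Fin 2 → ℝ) {ζ : Fin 2 → ℂ} (hζ : ‖ζ‖ < κ) :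
    ((fun i => (x i : ℂ)), ζ) ∈ complexNhd κ :=
  ⟨fun i => by simpa using (norm_nonneg _).trans_lt hζ, hζ⟩

theorem norm_add_smul_le (ξ : Fin 2 → ℂ) {e : ℝ} (he : 0 ≤ e) {ζ : Fin 2 → ℂ} (hζ : ‖ζ‖ ≤ 1) :
    ‖ξ + (e : ℂ) • ζ‖ ≤ ‖ξ‖ + e := by
  refine norm_add_le_of_le le_rfl ?_
  rw [norm_smul, norm_real, Real.norm_of_nonneg he]
  exact mul_le_of_le_one_right he hζ

theorem norm_add_smul_vec_le (ξ : Fin 2 → ℂ) {e : ℝ} (he : 0 ≤ e) {z w : ℂ} (hz : ‖z‖ ≤ 1)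
    (hw : ‖w‖ ≤ 1) : ‖ξ + (e : ℂ) • ![z, w]‖ ≤ ‖ξ‖ + e :=
  norm_add_smul_le ξ he
    ((pi_norm_le_iff_of_nonneg zero_le_one).mpr (Fin.forall_fin_two.mpr ⟨hz, hw⟩))

namespace IsPeriodicSymbol

variable {κ : ℝ} {f : (Fin 2 → ℂ) → (Fin 2 → ℂ) → ℂ}

theorem holomorphicOnStrip (hf : IsPeriodicSymbol κ f) {ζ : Fin 2 → ℂ} (hζ : ‖ζ‖ < κ) :
    HolomorphicOnStrip κ fun x => f x ζ where
  differentiableOn := hf.differentiableOn.comp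
    (differentiableOn_id.prodMk (differentiableOn_const ζ)) fun _ hx => ⟨hx, hζ⟩
  periodic x hx := hf.periodic x ζ ⟨hx, hζ⟩

theorem continuous_ofReal (hf : IsPeriodicSymbol κ f) :
    Continuous fun q : {ζ : Fin 2 → ℂ | ‖ζ‖ < κ} × (Fin 2 → ℝ) => f (fun i => q.2 i) q.1 :=
  hf.differentiableOn.continuousOn.comp_continuous
    (f := fun q : {ζ : Fin 2 → ℂ | ‖ζ‖ < κ} × (Fin 2 → ℝ) =>
      ((fun i => (q.2 i : ℂ)), (q.1 : Fin 2 → ℂ)))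
    (by fun_prop) fun q => ofReal_mem_complexNhd q.2 q.1.2

theorem diffContOnCl_comp (hf : IsPeriodicSymbol κ f) (x : Fin 2 → ℝ) {g : ℂ → Fin 2 → ℂ}
    (hg : Differentiable ℂ g) (hgκ : ∀ z : ℂ, ‖z‖ ≤ 1 → ‖g z‖ < κ) :
    DiffContOnCl ℂ (fun z => f (fun i => x i) (g z)) (Metric.ball 0 1) := by
  refine DifferentiableOn.diffContOnCl ?_
  rw [closure_ball _ one_ne_zero]
  exact hf.differentiableOn.comp (f := fun z => ((fun i => (x i : ℂ)), g z))
    ((differentiable_const _).prodMk hg).differentiableOn fun z hz =>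
      ofReal_mem_complexNhd x (hgκ z (by simpa using hz))

variable {a : NNReal} {ξ : Fin 2 → ℂ} {e B : ℝ}

theorem norm_fourierCoeffTorus_le (hf : IsPeriodicSymbol κ f) (haκ : 2 * (a : ℝ) < κ)
    {ζ : Fin 2 → ℂ} (hζ : ‖ζ‖ < κ) (hB : ∀ x, (x, ζ) ∈ complexNhd κ → ‖f x ζ‖ ≤ B)
    (k : Fin 2 → ℤ) :
    ‖fourierCoeffTorus (fun x => f (fun i => x i) ζ) k‖ ≤
      B * Real.exp (-(2 * a * freqLength k)) :=
  (hf.holomorphicOnStrip hζ).norm_fourierCoeffTorus_le_exp (fun x hx => hB x ⟨hx, hζ⟩)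
    (by positivity) haκ k

section SymbolSeries

variable (hf : IsPeriodicSymbol κ f) (ha : 0 < a) (haκ : 2 * (a : ℝ) < κ) (he : 0 ≤ e)
  (hξ : ‖ξ‖ + e < κ)
  (hB : ∀ x ζ, (x, ζ) ∈ complexNhd κ → ‖ζ‖ ≤ ‖ξ‖ + e → ‖f x ζ‖ ≤ B)
include hf ha haκ he hξ hB

theorem norm_symbolSeries_le {z w : ℂ} (hz : ‖z‖ ≤ 1) (hw : ‖w‖ ≤ 1) :
    ‖symbolSeries a f ξ e z w‖ ≤ decaySum a * B := by
  have hζ := norm_add_smul_vec_le ξ he hz hw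
  exact Wiener.norm_ofFunction_le ha
    (hf.norm_fourierCoeffTorus_le haκ (hζ.trans_lt hξ) fun x hx => hB x _ hx hζ)

theorem eval_symbolSeries {z w : ℂ} (hz : ‖z‖ ≤ 1) (hw : ‖w‖ ≤ 1) (x : Fin 2 → ℝ) :
    Wiener.eval x (symbolSeries a f ξ e z w) = f (fun i => x i) (ξ + (e : ℂ) • ![z, w]) := by
  have hζ := norm_add_smul_vec_le ξ he hz hw
  have hstrip := hf.holomorphicOnStrip (hζ.trans_lt hξ)
  have hκ : 0 < κ := (norm_nonneg _).trans_lt (hζ.trans_lt hξ)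
  exact Wiener.eval_ofFunction ha
    (hf.norm_fourierCoeffTorus_le haκ (hζ.trans_lt hξ) fun x hx => hB x _ hx hζ)
    (by simpa using hstrip.continuous_shift (t := 0) (by simpa)) (hstrip.torusPeriodic hκ) x

theorem continuousOn_symbolSeries :
    ContinuousOn (Function.uncurry (symbolSeries a f ξ e))
      (Metric.sphere 0 1 ×ˢ Metric.sphere 0 1) := by
  have hζ (p : ℂ × ℂ) (hp : p ∈ Metric.sphere (0 : ℂ) 1 ×ˢ Metric.sphere (0 : ℂ) 1) :
      ‖ξ + (e : ℂ) • ![p.1, p.2]‖ ≤ ‖ξ‖ + e :=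
    norm_add_smul_vec_le ξ he (mem_sphere_zero_iff_norm.mp hp.1).le
      (mem_sphere_zero_iff_norm.mp hp.2).le
  refine continuousOn_tsum (u := fun k => B * Real.exp (-(a * freqLength k))) (fun k => ?_)
    ((summable_exp_neg_mul_freqLength (NNReal.coe_pos.mpr ha)).mul_left B) fun k p hp =>
      Wiener.norm_fourierCoeffTorus_smul_mode_le
        (hf.norm_fourierCoeffTorus_le haκ ((hζ p hp).trans_lt hξ)
          (fun x hx => hB x _ hx (hζ p hp)) k)
  have hcoeff : ContinuousOn (fun ζ => fourierCoeffTorus (fun x => f (fun i => x i) ζ) k)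
      {ζ : Fin 2 → ℂ | ‖ζ‖ < κ} := by
    rw [continuousOn_iff_continuous_domRestrict]
    exact continuous_fourierCoeffTorus hf.continuous_ofReal k
  exact (hcoeff.comp (f := fun p : ℂ × ℂ => ξ + (e : ℂ) • ![p.1, p.2])
    (by fun_prop) fun p hp => (hζ p hp).trans_lt hξ).smul continuousOn_const

theorem norm_symbolSeries_le_of_mem_sphere :
    ∀ z ∈ Metric.sphere (0 : ℂ) 1, ∀ w ∈ Metric.sphere (0 : ℂ) 1,
      ‖symbolSeries a f ξ e z w‖ ≤ decaySum a * B := fun _ hz _ hw =>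
  norm_symbolSeries_le hf ha haκ he hξ hB (mem_sphere_zero_iff_norm.mp hz).le
    (mem_sphere_zero_iff_norm.mp hw).le

theorem norm_composition_le {v : Fin 2 → Wiener (Fin 2) a} (hv : ‖v‖ ≤ 1 / 2) :
    ‖composition a f ξ e v‖ ≤ 4 * (decaySum a * B) := by
  refine (norm_cauchyCalc₂_le (by norm_num)
    (norm_symbolSeries_le_of_mem_sphere hf ha haκ he hξ hB) hv).trans_eq ?_
  norm_num
  ring

theorem norm_composition_sub_le {v v' : Fin 2 → Wiener (Fin 2) a} (hv : ‖v‖ ≤ 1 / 2)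
    (hv' : ‖v'‖ ≤ 1 / 2) :
    ‖composition a f ξ e v - composition a f ξ e v'‖ ≤ 16 * (decaySum a * B) * ‖v - v'‖ := by
  refine (norm_cauchyCalc₂_sub_le (by norm_num)
    (continuousOn_symbolSeries hf ha haκ he hξ hB)
    (norm_symbolSeries_le_of_mem_sphere hf ha haκ he hξ hB) hv hv').trans_eq ?_
  ring

theorem eval_composition {v : Fin 2 → Wiener (Fin 2) a} (hv : ‖v‖ ≤ 1 / 2) (x : Fin 2 → ℝ) :
    Wiener.eval x (composition a f ξ e v) =
      f (fun i => x i) (ξ + (e : ℂ) • fun i => Wiener.eval x (v i)) := by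
  have hv_eta : (fun i => Wiener.eval x (v i)) = ![Wiener.eval x (v 0), Wiener.eval x (v 1)] :=
    funext (Fin.forall_fin_two.mpr ⟨rfl, rfl⟩)
  rw [hv_eta]
  refine map_cauchyCalc₂ (Wiener.eval x) (continuousOn_symbolSeries hf ha haκ he hξ hB)
    (hv.trans_lt (by norm_num))
    (g := fun z w => f (fun i => (x i : ℂ)) (ξ + (e : ℂ) • ![z, w])) (fun z hz => ?_)
    (fun w hw => ?_) fun z hz w hw => eval_symbolSeries hf ha haκ he hξ hB
      (mem_sphere_zero_iff_norm.mp hz).le (mem_sphere_zero_iff_norm.mp hw).le x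
  · exact hf.diffContOnCl_comp x (differentiable_add_smul_vec _ _ (differentiable_const z)
      differentiable_id) fun w hw =>
      (norm_add_smul_vec_le ξ he (mem_sphere_zero_iff_norm.mp hz).le hw).trans_lt hξ
  · exact hf.diffContOnCl_comp x (differentiable_add_smul_vec _ _ differentiable_id
      (differentiable_const w)) fun z hz =>
      (norm_add_smul_vec_le ξ he hz (mem_ball_zero_iff.mp hw).le).trans_lt hξ

end SymbolSeries

end IsPeriodicSymbol

end Composition

/-! ### Sobolev norms -/

section Sobolev

open BeurlingAlgebra

theorem circleCoeff_cexp (m n : ℤ) :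
    circleCoeff (fun x => Complex.exp (I * (m * x))) n = if m = n then 1 else 0 := by
  have hpi : (Real.pi : ℂ) ≠ 0 := ofReal_ne_zero.mpr Real.pi_ne_zero
  have hmul (x : ℝ) : Complex.exp (-(I * (n * x))) * Complex.exp (I * (m * x)) =
      Complex.exp (((m - n : ℤ) : ℂ) * I * x) := by
    rw [← Complex.exp_add]
    congr 1
    push_cast
    ring
  simp only [circleCoeff, hmul]
  split_ifs with hmn
  · simp [hmn]
    field_simp
  · have hc : ((m - n : ℤ) : ℂ) * I ≠ 0 :=
      mul_ne_zero (Int.cast_ne_zero.mpr (sub_ne_zero.mpr hmn)) I_ne_zero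
    have hperiod : Complex.exp (((m - n : ℤ) : ℂ) * I * (2 * Real.pi : ℝ)) = 1 := by
      rw [mul_assoc, mul_comm I]
      exact_mod_cast exp_int_mul_two_pi_mul_I (m - n)
    rw [integral_exp_mul_complex hc, hperiod, ofReal_zero, mul_zero, Complex.exp_zero, sub_self,
      zero_div, mul_zero]

theorem fourierCoeffTorus_torusChar (j k : Fin 2 → ℤ) :
    fourierCoeffTorus (fun x => torusChar x j) k = if j = k then 1 else 0 := by
  have hmul (x y : ℝ) : torusChar ![x, y] j =
      Complex.exp (I * (j 0 * x)) * Complex.exp (I * (j 1 * y)) := by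
    rw [torusChar_apply, Fin.sum_univ_two, mul_add, Complex.exp_add]
    rfl
  have hinner (x : ℝ) : circleCoeff (fun y => torusChar ![x, y] j) (k 1) =
      (if j 1 = k 1 then 1 else 0) * Complex.exp (I * (j 0 * x)) := by
    simp only [hmul, circleCoeff_const_mul, circleCoeff_cexp]
    exact mul_comm _ _
  have hjk : j = k ↔ j 1 = k 1 ∧ j 0 = k 0 := by
    rw [funext_iff, Fin.forall_fin_two, and_comm]
  rw [fourierCoeffTorus_eq_circleCoeff (contDiff_torusChar j).continuous]
  simp only [hinner, circleCoeff_const_mul, circleCoeff_cexp, hjk, ite_and]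
  rw [ite_zero_mul, one_mul]

theorem fourierCoeffTorus_add {u v : (Fin 2 → ℝ) → ℂ} (hu : Continuous u) (hv : Continuous v)
    (k : Fin 2 → ℤ) :
    fourierCoeffTorus (fun x => u x + v x) k = fourierCoeffTorus u k + fourierCoeffTorus v k := by
  simp only [fourierCoeffTorus, add_mul, ← mul_add]
  rw [integral_add] <;>
    exact (Continuous.continuousOn (by fun_prop)).integrableOn_compact isCompact_Icc

theorem fourierCoeffTorus_const_mul (c : ℂ) (u : (Fin 2 → ℝ) → ℂ) (k : Fin 2 → ℤ) :
    fourierCoeffTorus (fun x => c * u x) k = c * fourierCoeffTorus u k := by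
  simp only [fourierCoeffTorus, mul_assoc, integral_const_mul]
  exact mul_left_comm _ _ _

theorem exists_sobolevWeight_le {a : NNReal} (ha : 0 < a) (s : ℝ) :
    ∃ C : ℝ, 0 ≤ C ∧ ∀ k : Fin 2 → ℤ,
      (1 + ∑ i, (k i : ℝ) ^ 2) ^ s ≤ C * expWeight (Fin 2) a k ^ 2 := by
  obtain ⟨n, hn⟩ := exists_nat_ge s
  obtain ⟨C, hC0, hC⟩ := exists_one_add_pow_le_mul_exp
    (b := 2 * a) (mul_pos two_pos (NNReal.coe_pos.mpr ha)) (2 * n)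
  refine ⟨C, hC0, fun k => ?_⟩
  have hone : 1 ≤ 1 + ∑ i, (k i : ℝ) ^ 2 :=
    le_add_of_nonneg_right (Finset.sum_nonneg fun i _ => sq_nonneg _)
  have hle : 1 + ∑ i, (k i : ℝ) ^ 2 ≤ (1 + freqLength k) ^ 2 := by
    simp only [freqLength, Fin.sum_univ_two, ← sq_abs (k _ : ℝ)]
    nlinarith [abs_nonneg (k 0 : ℝ), abs_nonneg (k 1 : ℝ),
      mul_nonneg (abs_nonneg (k 0 : ℝ)) (abs_nonneg (k 1 : ℝ))]
  calc (1 + ∑ i, (k i : ℝ) ^ 2) ^ s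
    _ ≤ (1 + ∑ i, (k i : ℝ) ^ 2) ^ (n : ℝ) := Real.rpow_le_rpow_of_exponent_le hone hn
    _ = (1 + ∑ i, (k i : ℝ) ^ 2) ^ n := Real.rpow_natCast _ _
    _ ≤ ((1 + freqLength k) ^ 2) ^ n := pow_le_pow_left₀ (zero_le_one.trans hone) hle n
    _ = (1 + freqLength k) ^ (2 * n) := (pow_mul _ _ _).symm
    _ ≤ C * Real.exp (2 * a * freqLength k) := hC _ (freqLength_nonneg k)
    _ = C * expWeight (Fin 2) a k ^ 2 := by
      rw [expWeight_apply, ← Real.exp_nat_mul, mul_assoc, Nat.cast_ofNat]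

theorem tsum_enorm_coeff_sq_le {G : Type*} [AddMonoid G] {w : BeurlingWeight G}
    (f : BeurlingAlgebra w) :
    ∑' k, ENNReal.ofReal (w k ^ 2) * ‖coeff k f‖ₑ ^ 2 ≤ ENNReal.ofReal (‖f‖ ^ 2) := by
  have hsum := hasSum_norm_coeff_mul f
  have hnonneg (k : G) : 0 ≤ ‖coeff k f‖ * w k := mul_nonneg (norm_nonneg _) (w.pos k).le
  have hterm (k : G) : ENNReal.ofReal (w k ^ 2) * ‖coeff k f‖ₑ ^ 2 ≤
      ENNReal.ofReal (‖f‖ * (‖coeff k f‖ * w k)) := by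
    rw [← ofReal_norm, ← ENNReal.ofReal_pow (norm_nonneg _),
      ← ENNReal.ofReal_mul (sq_nonneg _), ← mul_pow, mul_comm (w k), sq]
    exact ENNReal.ofReal_le_ofReal (mul_le_mul_of_nonneg_right
      (le_hasSum hsum k fun j _ => hnonneg j) (hnonneg k))
  refine (ENNReal.tsum_le_tsum hterm).trans_eq ?_
  rw [← ENNReal.ofReal_tsum_of_nonneg (fun k => mul_nonneg (norm_nonneg _) (hnonneg k))
    (hsum.summable.mul_left _), tsum_mul_left, hsum.tsum_eq, sq]

namespace Wiener

variable {a : NNReal}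

theorem fourierCoeffTorus_eval (ha : 0 < a) (f : Wiener (Fin 2) a) (k : Fin 2 → ℤ) :
    fourierCoeffTorus (fun x => eval x f) k = coeff k f := by
  have hcont (f : Wiener (Fin 2) a) : Continuous fun x => eval x f :=
    (contDiff_eval ha f).continuous
  let L : Wiener (Fin 2) a →L[ℂ] ℂ := LinearMap.mkContinuous
    { toFun := fun f => fourierCoeffTorus (fun x => eval x f) k
      map_add' := fun f g => by
        simpa only [map_add] using fourierCoeffTorus_add (hcont f) (hcont g) k
      map_smul' := fun c f => by
        simpa only [map_smul, smul_eq_mul, RingHom.id_apply] using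
          fourierCoeffTorus_const_mul c (fun x => eval x f) k } 1
    fun f => (norm_fourierCoeffTorus_le (hcont f) (fun x => AlgHom.norm_apply_le_self (eval x) f)
      k).trans_eq (one_mul _).symm
  have hL : L = coeff k := hom_ext fun j => by
    change fourierCoeffTorus (fun x => eval x (mode j)) k = coeff k (mode j)
    simp only [eval_mode, fourierCoeffTorus_torusChar]
    split_ifs with hjk
    · rw [hjk, coeff_mode_self]
    · rw [coeff_mode_of_ne (Ne.symm hjk)]
  exact DFunLike.congr_fun hL f

theorem exists_sobolevNorm_le (ha : 0 < a) (s : ℝ) :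
    ∃ D : ℝ, 0 ≤ D ∧ ∀ v : Fin 2 → Wiener (Fin 2) a,
      sobolevNorm s (fun x j => eval x (v j)) ≤ ENNReal.ofReal (D * ‖v‖) := by
  obtain ⟨C, hC0, hC⟩ := exists_sobolevWeight_le ha s
  refine ⟨√(2 * C), Real.sqrt_nonneg _, fun v => ?_⟩
  have hsum : ∑' k : Fin 2 → ℤ, ENNReal.ofReal ((1 + ∑ i, (k i : ℝ) ^ 2) ^ s) *
      ∑ j, ‖fourierCoeffTorus (fun x => eval x (v j)) k‖ₑ ^ 2 ≤
      ENNReal.ofReal ((√(2 * C) * ‖v‖) ^ 2) := by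
    simp only [fourierCoeffTorus_eval ha]
    calc _ ≤ ∑' k : Fin 2 → ℤ, ∑ j, ENNReal.ofReal C *
          (ENNReal.ofReal (expWeight (Fin 2) a k ^ 2) * ‖coeff k (v j)‖ₑ ^ 2) := by
          refine ENNReal.tsum_le_tsum fun k => ?_
          rw [Finset.mul_sum]
          refine Finset.sum_le_sum fun j _ => ?_
          rw [← mul_assoc, ← ENNReal.ofReal_mul hC0]
          gcongr
          exact hC k
      _ = ∑ j, ENNReal.ofReal C * ∑' k : Fin 2 → ℤ,
          ENNReal.ofReal (expWeight (Fin 2) a k ^ 2) * ‖coeff k (v j)‖ₑ ^ 2 := by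
          rw [Summable.tsum_finsetSum fun _ _ => ENNReal.summable]
          simp only [ENNReal.tsum_mul_left]
      _ ≤ ∑ _j : Fin 2, ENNReal.ofReal C * ENNReal.ofReal (‖v‖ ^ 2) := by
          gcongr with j
          exact (tsum_enorm_coeff_sq_le (v j)).trans (ENNReal.ofReal_le_ofReal
            (pow_le_pow_left₀ (norm_nonneg _) (norm_le_pi_norm v j) 2))
      _ = ENNReal.ofReal ((√(2 * C) * ‖v‖) ^ 2) := by
          rw [Fin.sum_univ_two, ← ENNReal.ofReal_mul hC0, ← ENNReal.ofReal_add (by positivity)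
            (by positivity), mul_pow, Real.sq_sqrt (by positivity), ← two_mul, mul_assoc]
  rw [sobolevNorm]
  refine (ENNReal.rpow_le_rpow hsum (by norm_num)).trans_eq ?_
  rw [ENNReal.ofReal_rpow_of_nonneg (by positivity) (by norm_num), ← Real.sqrt_eq_rpow,
    Real.sqrt_sq (by positivity)]

end Wiener

end Sobolev

/-! ### The transport operator -/

section Transport

open BeurlingAlgebra

section Inverse

variable {ι : Type*} [Fintype ι]

theorem abs_le_freqLength (k : ι → ℤ) (i : ι) : |(k i : ℝ)| ≤ freqLength k :=
  Finset.single_le_sum (f := fun i => |(k i : ℝ)|) (fun _ _ => abs_nonneg _) (Finset.mem_univ i)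

theorem abs_sum_mul_le_mul_freqLength {u : ι → ℝ} {Λ : ℝ} (hu : ∀ i, |u i| ≤ Λ) (k : ι → ℤ) :
    |∑ i, u i * k i| ≤ Λ * freqLength k := by
  refine (Finset.abs_sum_le_sum_abs _ _).trans ?_
  rw [freqLength, Finset.mul_sum]
  refine Finset.sum_le_sum fun i _ => ?_
  rw [abs_mul]
  exact mul_le_mul_of_nonneg_right (hu i) (abs_nonneg _)

theorem one_le_freqLength {k : ι → ℤ} (hk : k ≠ 0) : 1 ≤ freqLength k := by
  obtain ⟨i, hi⟩ := Function.ne_iff.mp hk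
  exact le_trans (by exact_mod_cast Int.one_le_abs hi) (abs_le_freqLength k i)

/-- The symbol `l·k` of the constant-coefficient operator `(1/i) l·∂_x` on the torus. -/
def transportSymbol (l : ι → ℂ) (k : ι → ℤ) : ℂ := ∑ i, l i * k i

theorem transportSymbol_zero (l : ι → ℂ) : transportSymbol l 0 = 0 := by simp [transportSymbol]

variable {a : NNReal} {l g₀ : ι → ℂ} {Q : ℝ} (hl : ∀ k, freqLength k ≤ Q * ‖transportSymbol l k‖)
  (hg₀ : ∀ i, ‖g₀ i‖ ≤ Q)

include hl in
theorem transportSymbol_ne_zero {k : ι → ℤ} (hk : k ≠ 0) : transportSymbol l k ≠ 0 := fun h => by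
  have hpos := zero_lt_one.trans_le ((one_le_freqLength hk).trans (hl k))
  rw [h, norm_zero, mul_zero] at hpos
  exact hpos.false

/-- The Fourier symbol of `transportGrad`: nonzero modes are inverted, and the constant `1` is the
image of the constant gradient `g₀`. -/
def transportGradSymbol (l g₀ : ι → ℂ) (i : ι) (k : ι → ℤ) : ℂ :=
  open Classical in if k = 0 then g₀ i else k i / transportSymbol l k

include hl hg₀ in
theorem norm_transportGradSymbol_le (i : ι) (k : ι → ℤ) : ‖transportGradSymbol l g₀ i k‖ ≤ Q := by
  rw [transportGradSymbol]
  split_ifs with hk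
  · exact hg₀ i
  · rw [norm_div, div_le_iff₀ (norm_pos_iff.mpr (transportSymbol_ne_zero hl hk)), norm_intCast]
    exact (abs_le_freqLength k i).trans (hl k)

/-- The `i`-th component of the gradient field solving `l·v = f`, as an operator on `f`. -/
def transportGrad (i : ι) : Wiener ι a →L[ℂ] Wiener ι a :=
  multiplier (transportGradSymbol l g₀ i) Q (norm_transportGradSymbol_le hl hg₀ i)

theorem norm_transportGrad_le (i : ι) (f : Wiener ι a) : ‖transportGrad hl hg₀ i f‖ ≤ Q * ‖f‖ :=
  (transportGrad hl hg₀ i).le_of_opNorm_le (norm_multiplier_le _ _ _) f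

theorem sum_smul_transportGrad (hlg : ∑ i, l i * g₀ i = 1) (f : Wiener ι a) :
    ∑ i, l i • transportGrad hl hg₀ i f = f := by
  have hsymbol (k : ι → ℤ) : ∑ i, l i * transportGradSymbol l g₀ i k = 1 := by
    obtain rfl | hk := eq_or_ne k 0
    · simpa only [transportGradSymbol, if_true] using hlg
    · simp only [transportGradSymbol, if_neg hk, ← mul_div_assoc, ← Finset.sum_div]
      exact div_self (transportSymbol_ne_zero hl hk)
  have hid : ∑ i, l i • transportGrad hl hg₀ i = ContinuousLinearMap.id ℂ (Wiener ι a) :=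
    hom_ext fun k => by
      simp only [sum_apply, smul_apply, transportGrad, multiplier, lift_mode, smul_smul,
        ← Finset.sum_smul, hsymbol, one_smul, ContinuousLinearMap.id_apply]
  have hf := DFunLike.congr_fun hid f
  rwa [sum_apply] at hf

include hl in
theorem norm_inv_I_mul_transportSymbol_le (k : ι → ℤ) : ‖(I * transportSymbol l k)⁻¹‖ ≤ |Q| := by
  obtain rfl | hk := eq_or_ne k 0
  · rw [transportSymbol_zero, mul_zero, inv_zero, norm_zero]
    exact abs_nonneg Q
  · rw [norm_inv, norm_mul, norm_I, one_mul,
      inv_le_iff_one_le_mul₀ (norm_pos_iff.mpr (transportSymbol_ne_zero hl hk))]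
    exact ((one_le_freqLength hk).trans (hl k)).trans
      (mul_le_mul_of_nonneg_right (le_abs_self Q) (norm_nonneg _))

/-- The periodic function whose gradient is the mean-free part of `transportGrad`. The zero mode
is annihilated because `transportSymbol l 0 = 0` and `0⁻¹ = 0`. -/
def transportPotential : Wiener ι a →L[ℂ] Wiener ι a :=
  multiplier (fun k => (I * transportSymbol l k)⁻¹) |Q| (norm_inv_I_mul_transportSymbol_le hl)

theorem eval_transportGrad [DecidableEq ι] (ha : 0 < a) (f : Wiener ι a) (i : ι) (x : ι → ℝ) :
    Wiener.eval x (transportGrad hl hg₀ i f) =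
      fderiv ℝ (fun x => Wiener.eval x (transportPotential hl f)) x (Pi.single i 1) +
        coeff 0 f * g₀ i := by
  have hcoeff (k : ι → ℤ) :
      coeff k (transportGrad hl hg₀ i f - (coeff 0 f * g₀ i) • mode 0) =
        I * k i * coeff k (transportPotential hl f) := by
    rw [map_sub, map_smul, transportGrad, transportPotential, coeff_multiplier, coeff_multiplier,
      smul_eq_mul]
    obtain rfl | hk := eq_or_ne k 0
    · rw [coeff_mode_self, transportGradSymbol, if_pos rfl, Pi.zero_apply, Int.cast_zero]
      ring
    · have hσ := transportSymbol_ne_zero hl hk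
      rw [coeff_mode_of_ne hk, transportGradSymbol, if_neg hk]
      field_simp [I_ne_zero]
      ring
  rw [Wiener.fderiv_eval_single ha hcoeff, map_sub, map_smul, Wiener.eval_mode,
    AddChar.map_zero_eq_one, smul_eq_mul, mul_one, sub_add_cancel]

end Inverse

section Plane

variable {l₁ l₂ : Fin 2 → ℂ} {c Λ ε : ℝ}

theorem abs_det_mul_freqLength_le {u v : Fin 2 → ℝ} (hu : ∀ i, |u i| ≤ Λ) (hv : ∀ i, |v i| ≤ Λ)
    (k : Fin 2 → ℤ) :
    |u 0 * v 1 - u 1 * v 0| * freqLength k ≤ 2 * Λ * (|∑ i, u i * k i| + |∑ i, v i * k i|) := by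
  rw [freqLength]
  simp only [Fin.sum_univ_two]
  set A := u 0 * k 0 + u 1 * k 1
  set B := v 0 * k 0 + v 1 * k 1
  have cramer₀ : (u 0 * v 1 - u 1 * v 0) * k 0 = A * v 1 - B * u 1 := by ring
  have cramer₁ : (u 0 * v 1 - u 1 * v 0) * k 1 = B * u 0 - A * v 0 := by ring
  have bound {s t : ℝ} (hs : |s| ≤ Λ) (ht : |t| ≤ Λ) : |A * s - B * t| ≤ (|A| + |B|) * Λ := by
    refine (abs_sub _ _).trans ?_
    rw [abs_mul, abs_mul, add_mul]
    gcongr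
  have bound₀ := bound (hv 1) (hu 1)
  have bound₁ := bound (hv 0) (hu 0)
  rw [mul_add, ← abs_mul, ← abs_mul, cramer₀, cramer₁, abs_sub_comm (B * u 0)]
  linarith

/-- Quantitative form of the hypothesis that `l₁` and `Re l₂` are linearly independent, for a real
covector `l₁`: all coefficients are bounded by `Λ` and the determinant is at least `c`. -/
structure IsNondegeneratePair (c Λ : ℝ) (l₁ l₂ : Fin 2 → ℂ) : Prop where
  im_eq_zero : ∀ i, (l₁ i).im = 0
  norm_left_le : ∀ i, ‖l₁ i‖ ≤ Λ
  norm_right_le : ∀ i, ‖l₂ i‖ ≤ Λ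
  le_abs_det : c ≤ |(l₁ 0).re * (l₂ 1).re - (l₁ 1).re * (l₂ 0).re|

/-- The complex covector `l₁ + iε l₂`. -/
def complexCovector (l₁ l₂ : Fin 2 → ℂ) (ε : ℝ) (i : Fin 2) : ℂ := l₁ i + I * ε * l₂ i

theorem re_transportSymbol (k : Fin 2 → ℤ) :
    (transportSymbol (complexCovector l₁ l₂ ε) k).re =
      ∑ i, (l₁ i).re * k i - ε * ∑ i, (l₂ i).im * k i := by
  simp only [transportSymbol, complexCovector, Fin.sum_univ_two, add_re, mul_re, I_re, ofReal_re,
    zero_mul, I_im, ofReal_im, mul_zero, sub_self, mul_im, one_mul, zero_add, zero_sub, intCast_re,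
    add_im, intCast_im, sub_zero]
  ring

/-- The linear form with coefficients `m`. -/
def linearForm (m : Fin 2 → ℂ) : (Fin 2 → ℝ) →ₗ[ℝ] ℂ :=
  ∑ i, (LinearMap.toSpanSingleton ℝ ℂ (m i)).comp (LinearMap.proj i)

theorem linearForm_single (m : Fin 2 → ℂ) (i : Fin 2) : linearForm m (Pi.single i 1) = m i := by
  fin_cases i <;> simp [linearForm, LinearMap.toSpanSingleton_apply]

theorem contDiff_wStar (ε : ℝ) (y : Fin 2 → ((Fin 2 → ℝ) →ₗ[ℝ] ℂ)) : ContDiff ℝ ∞ (wStar ε y) :=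
  (((1 / 2 : ℂ) • ((ε : ℂ) • y 0 + (1 / I : ℂ) • y 1)).toContinuousLinearMap).contDiff

/-- The gradient of `w^*`. -/
def gradWStar (ε : ℝ) (y : Fin 2 → ((Fin 2 → ℝ) →ₗ[ℝ] ℂ)) (i : Fin 2) : ℂ :=
  wStar ε y (Pi.single i 1)

theorem hasFDerivAt_wStar (ε : ℝ) (y : Fin 2 → ((Fin 2 → ℝ) →ₗ[ℝ] ℂ)) (x : Fin 2 → ℝ) :
    HasFDerivAt (wStar ε y)
      (((1 / 2 : ℂ) • ((ε : ℂ) • y 0 + (1 / I : ℂ) • y 1)).toContinuousLinearMap) x :=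
  (((1 / 2 : ℂ) • ((ε : ℂ) • y 0 + (1 / I : ℂ) • y 1)).toContinuousLinearMap).hasFDerivAt

theorem grad_add_mul_wStar {u : (Fin 2 → ℝ) → ℂ} (hu : ContDiff ℝ ∞ u) (b : ℂ) (ε : ℝ)
    (y : Fin 2 → ((Fin 2 → ℝ) →ₗ[ℝ] ℂ)) (x : Fin 2 → ℝ) (i : Fin 2) :
    grad (fun x => u x + b * wStar ε y x) x i = grad u x i + b * gradWStar ε y i := by
  have hsum : HasFDerivAt (fun x => u x + b * wStar ε y x) _ x :=
    ((hu.differentiable (by simp)) x).hasFDerivAt.add ((hasFDerivAt_wStar ε y x).const_mul b)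
  rw [grad, hsum.fderiv]
  rfl

theorem sum_mul_gradWStar {y : Fin 2 → ((Fin 2 → ℝ) →ₗ[ℝ] ℂ)} (hy : IsDualPair ![l₁, l₂] y) :
    ∑ i, complexCovector l₁ l₂ ε i * gradWStar ε y i = ε := by
  have h₀₀ := hy 0 0
  have h₀₁ := hy 0 1
  have h₁₀ := hy 1 0
  have h₁₁ := hy 1 1
  simp only [Fin.sum_univ_two, Matrix.cons_val_zero, Matrix.cons_val_one, if_pos, zero_ne_one,
    one_ne_zero, if_false] at h₀₀ h₀₁ h₁₀ h₁₁
  simp only [Fin.sum_univ_two, complexCovector, gradWStar, wStar, one_div, inv_I]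
  linear_combination (ε / 2 : ℂ) * h₀₀ + (-I / 2) * h₀₁ + (I * ε ^ 2 / 2) * h₁₀ +
    (ε / 2 : ℂ) * h₁₁ - (ε / 2 : ℂ) * (l₂ 0 * y 1 (Pi.single 0 1) + l₂ 1 * y 1 (Pi.single 1 1)) *
      I_sq

theorem norm_gradWStar_le {y : Fin 2 → ((Fin 2 → ℝ) →ₗ[ℝ] ℂ)} {Y : ℝ} (hε : |ε| ≤ 1)
    (hy : ∀ j i, ‖y j (Pi.single i 1)‖ ≤ Y) (i : Fin 2) : ‖gradWStar ε y i‖ ≤ Y := by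
  have hsum : ‖(ε : ℂ) * y 0 (Pi.single i 1) + 1 / I * y 1 (Pi.single i 1)‖ ≤ 1 * Y + 1 * Y := by
    refine norm_add_le_of_le ?_ ?_
    · rw [norm_mul, norm_real, Real.norm_eq_abs]
      gcongr
      exact hy 0 i
    · rw [norm_mul]
      gcongr
      · simp
      · exact hy 1 i
  rw [gradWStar, wStar, norm_mul, norm_div, norm_one, Complex.norm_ofNat]
  linarith

/-- `T` inverts the transport operator `(l₁ + iε l₂) · ∂_x` on the level of gradients: `T f` is the
gradient of a function of the form `ρ_per + b w^*` that the operator maps to `f`. Elements of the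
Wiener algebra stand for the periodic functions they define. -/
structure IsTransportInverse {a : NNReal} (l₁ l₂ : Fin 2 → ℂ) (ε : ℝ)
    (y : Fin 2 → ((Fin 2 → ℝ) →ₗ[ℝ] ℂ)) (T : Wiener (Fin 2) a →L[ℂ] (Fin 2 → Wiener (Fin 2) a)) :
    Prop where
  sum_smul : ∀ f, ∑ j, complexCovector l₁ l₂ ε j • T f j = f
  exists_potential : ∀ f, ∃ (ρper : (Fin 2 → ℝ) → ℂ) (b : ℂ),
    ContDiff ℝ ∞ ρper ∧ TorusPeriodic ρper ∧
      grad (fun x => ρper x + b * wStar ε y x) = fun x j => Wiener.eval x (T f j)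

namespace IsNondegeneratePair

variable (H : IsNondegeneratePair c Λ l₁ l₂)
include H

theorem exists_isDualPair (hc : 0 < c) :
    ∃ y : Fin 2 → ((Fin 2 → ℝ) →ₗ[ℝ] ℂ), IsDualPair ![l₁, l₂] y ∧
      ∀ j i, ‖y j (Pi.single i 1)‖ ≤ Λ / c := by
  obtain ⟨d, hd_def⟩ : ∃ d, d = l₁ 0 * l₂ 1 - l₁ 1 * l₂ 0 := ⟨_, rfl⟩
  have hcd : c ≤ ‖d‖ := by
    have hre : (l₁ 0).re * (l₂ 1).re - (l₁ 1).re * (l₂ 0).re = d.re := by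
      simp [hd_def, H.im_eq_zero]
    exact (hre ▸ H.le_abs_det).trans (abs_re_le_norm d)
  have hd : d ≠ 0 := norm_pos_iff.mp (hc.trans_le hcd)
  have bound {z : ℂ} (hz : ‖z‖ ≤ Λ) : ‖z / d‖ ≤ Λ / c := by
    rw [norm_div]
    exact div_le_div₀ ((norm_nonneg z).trans hz) hz hc hcd
  refine ⟨![linearForm ![l₂ 1 / d, -l₂ 0 / d], linearForm ![-l₁ 1 / d, l₁ 0 / d]], ?_, ?_⟩
  · simp only [IsDualPair, Fin.forall_fin_two, Fin.sum_univ_two, Matrix.cons_val_zero,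
      Matrix.cons_val_one, linearForm_single, ← mul_div_assoc, ← add_div, div_eq_iff hd]
    simp only [hd_def, if_true, zero_ne_one, one_ne_zero, if_false, zero_mul, one_mul]
    exact ⟨⟨by ring, by ring⟩, by ring, by ring⟩
  · simp only [Fin.forall_fin_two, Matrix.cons_val_zero, Matrix.cons_val_one, linearForm_single]
    exact ⟨⟨bound (H.norm_right_le 1), bound (by simpa using H.norm_right_le 0)⟩,
      bound (by simpa using H.norm_left_le 1), bound (H.norm_left_le 0)⟩

theorem im_transportSymbol (ε : ℝ) (k : Fin 2 → ℤ) :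
    (transportSymbol (complexCovector l₁ l₂ ε) k).im = ε * ∑ i, (l₂ i).re * k i := by
  simp only [transportSymbol, complexCovector, Fin.sum_univ_two, add_im, mul_im, add_re, mul_re,
    I_re, ofReal_re, zero_mul, I_im, ofReal_im, mul_zero, sub_self, one_mul, zero_add, zero_sub,
    intCast_im, H.im_eq_zero, intCast_re]
  ring

theorem freqLength_le (hc : 0 < c) (hε : 0 < ε) (hε1 : ε ≤ 1) (hεΛ : ε * (4 * Λ ^ 2) ≤ c)
    (k : Fin 2 → ℤ) :
    freqLength k ≤ 8 * Λ / c / ε * ‖transportSymbol (complexCovector l₁ l₂ ε) k‖ := by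
  set n := freqLength k
  set σ := transportSymbol (complexCovector l₁ l₂ ε) k
  set A := ∑ i, (l₁ i).re * k i
  set B := ∑ i, (l₂ i).re * k i
  set D := ∑ i, (l₂ i).im * k i
  have hn : 0 ≤ n := freqLength_nonneg k
  have hΛ : 0 ≤ Λ := (norm_nonneg _).trans (H.norm_left_le 0)
  have hre : σ.re = A - ε * D := re_transportSymbol k
  have him : σ.im = ε * B := H.im_transportSymbol ε k
  have hD : |D| ≤ Λ * n :=
    abs_sum_mul_le_mul_freqLength (fun i => (abs_im_le_norm _).trans (H.norm_right_le i)) k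
  have hB : ε * |B| ≤ ‖σ‖ := by
    refine le_of_eq_of_le ?_ (abs_im_le_norm σ)
    rw [him, abs_mul, abs_of_pos hε]
  have hA : |A| ≤ ‖σ‖ + ε * (Λ * n) := by
    rw [← sub_add_cancel A (ε * D), ← hre]
    refine (abs_add_le _ _).trans (add_le_add (abs_re_le_norm σ) ?_)
    rw [abs_mul, abs_of_pos hε]
    gcongr
  have hcn : c * n ≤ 2 * Λ * (|A| + |B|) :=
    (mul_le_mul_of_nonneg_right H.le_abs_det hn).trans (abs_det_mul_freqLength_le
      (fun i => (abs_re_le_norm _).trans (H.norm_left_le i))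
      (fun i => (abs_re_le_norm _).trans (H.norm_right_le i)) k)
  have habsorb : ε * (c * n) ≤ 4 * Λ * ‖σ‖ + ε * (c * n) / 2 := by
    calc ε * (c * n)
      _ ≤ ε * (2 * Λ * (|A| + |B|)) := by gcongr
      _ = 2 * Λ * (ε * |A| + ε * |B|) := by ring
      _ ≤ 2 * Λ * (ε * (‖σ‖ + ε * (Λ * n)) + ‖σ‖) := by gcongr
      _ = 2 * Λ * (ε * ‖σ‖ + ‖σ‖) + ε * (4 * Λ ^ 2) * (ε * n / 2) := by ring
      _ ≤ 2 * Λ * (1 * ‖σ‖ + ‖σ‖) + c * (ε * n / 2) := by gcongr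
      _ = 4 * Λ * ‖σ‖ + ε * (c * n) / 2 := by ring
  rw [div_div, div_mul_eq_mul_div, le_div_iff₀ (by positivity)]
  linarith

theorem exists_transport_inverse {a : NNReal} (ha : 0 < a) (hc : 0 < c) (hε : 0 < ε)
    (hε1 : ε ≤ 1) (hεΛ : ε * (4 * Λ ^ 2) ≤ c) :
    ∃ y, IsDualPair ![l₁, l₂] y ∧
      ∃ T : Wiener (Fin 2) a →L[ℂ] (Fin 2 → Wiener (Fin 2) a),
        ‖T‖ ≤ 8 * Λ / c / ε ∧ IsTransportInverse l₁ l₂ ε y T := by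
  obtain ⟨y, hy, hnorm⟩ := H.exists_isDualPair hc
  have hεc : (ε : ℂ) ≠ 0 := ofReal_ne_zero.mpr hε.ne'
  have hΛ : 0 ≤ Λ := (norm_nonneg _).trans (H.norm_left_le 0)
  have hl := H.freqLength_le hc hε hε1 hεΛ
  have hg₀ (j : Fin 2) : ‖gradWStar ε y j / ε‖ ≤ 8 * Λ / c / ε := by
    rw [norm_div, norm_real, Real.norm_of_nonneg hε.le]
    gcongr
    refine (norm_gradWStar_le ((abs_of_pos hε).trans_le hε1) hnorm j).trans ?_
    gcongr
    linarith
  have hlg : ∑ j, complexCovector l₁ l₂ ε j * (gradWStar ε y j / ε) = 1 := by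
    simp only [← mul_div_assoc, ← Finset.sum_div, sum_mul_gradWStar hy, div_self hεc]
  refine ⟨y, hy, ContinuousLinearMap.pi (transportGrad hl hg₀),
    ContinuousLinearMap.opNorm_le_bound _ (by positivity) fun f =>
      (pi_norm_le_iff_of_nonneg (by positivity)).mpr fun j => norm_transportGrad_le hl hg₀ j f,
    sum_smul_transportGrad hl hg₀ hlg, fun f => ⟨fun x => Wiener.eval x (transportPotential hl f),
      coeff 0 f / ε, Wiener.contDiff_eval ha _, Wiener.torusPeriodic_eval _, ?_⟩⟩
  funext x j
  rw [grad_add_mul_wStar (Wiener.contDiff_eval ha _), ContinuousLinearMap.coe_pi',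
    eval_transportGrad hl hg₀ ha, grad]
  ring

end IsNondegeneratePair

end Plane

end Transport

/-! ### The normal form -/

section NormalForm

open MvPolynomial

/-- The remainder of the first order Taylor expansion at `ξ` of the normal form `p + iεq`, for
increments `h` in a commutative complex algebra. -/
def normalFormRemainder {A : Type*} [CommRing A] [Algebra ℂ A] (p : MvPolynomial (Fin 2) ℝ)
    (q : MvPolynomial (Fin 3) ℂ) (ξ : Fin 2 → ℂ) (ε : ℝ) (h : Fin 2 → A) : A :=
  taylorRemainder p (algebraMap ℂ A ∘ ξ) h +
    (I * ε) • taylorRemainder q (algebraMap ℂ A ∘ ![ξ 0, ξ 1, (ε : ℂ)]) ![h 0, h 1, 0]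

theorem normalFormRemainder_zero {A : Type*} [CommRing A] [Algebra ℂ A]
    (p : MvPolynomial (Fin 2) ℝ) (q : MvPolynomial (Fin 3) ℂ) (ξ : Fin 2 → ℂ) (ε : ℝ) :
    normalFormRemainder p q ξ ε (0 : Fin 2 → A) = 0 := by
  have h0 : ![(0 : Fin 2 → A) 0, (0 : Fin 2 → A) 1, 0] = 0 := by simp
  rw [normalFormRemainder, h0, taylorRemainder_zero, taylorRemainder_zero, smul_zero, add_zero]

theorem map_normalFormRemainder {A : Type*} [CommRing A] [Algebra ℂ A] (χ : A →ₐ[ℂ] ℂ)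
    (p : MvPolynomial (Fin 2) ℝ) (q : MvPolynomial (Fin 3) ℂ) (ξ : Fin 2 → ℂ) (ε : ℝ)
    (h : Fin 2 → A) :
    χ (normalFormRemainder p q ξ ε h) =
      normalForm p q (fun i => ξ i + χ (h i)) ε - normalForm p q ξ ε -
        ∑ i, complexCovector (gradP p ξ) (gradQ q ξ ε) ε i * χ (h i) := by
  have hconst {σ : Type} (ζ : σ → ℂ) : χ ∘ algebraMap ℂ A ∘ ζ = ζ :=
    funext fun i => χ.commutes (ζ i)
  have hvec : χ ∘ ![h 0, h 1, 0] = ![χ (h 0), χ (h 1), 0] := by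
    funext i
    fin_cases i
    exacts [rfl, rfl, map_zero χ]
  have hp : χ (taylorRemainder p (algebraMap ℂ A ∘ ξ) h) = taylorRemainder p ξ (χ ∘ h) := by
    have hmap := map_taylorRemainder (χ.restrictScalars ℝ) p (algebraMap ℂ A ∘ ξ) h
    rwa [AlgHom.coe_restrictScalars', hconst] at hmap
  have hadd : ![ξ 0, ξ 1, (ε : ℂ)] + ![χ (h 0), χ (h 1), 0] =
      ![ξ 0 + χ (h 0), ξ 1 + χ (h 1), (ε : ℂ)] := by simp
  rw [normalFormRemainder, map_add, map_smul, hp, map_taylorRemainder, hconst, hvec,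
    taylorRemainder, taylorRemainder, hadd]
  have haeval (z : Fin 3 → ℂ) (P : MvPolynomial (Fin 3) ℂ) : aeval z P = eval z P :=
    DFunLike.congr_fun (coe_aeval_eq_eval z) P
  have hcast : (0 : Fin 2).castSucc = 0 ∧ (1 : Fin 2).castSucc = 1 := ⟨rfl, rfl⟩
  have hξh : (fun i => ξ i + χ (h i)) = ξ + χ ∘ h := rfl
  simp only [normalForm, complexCovector, gradP, gradQ, Fin.sum_univ_two, Fin.sum_univ_three,
    haeval, hcast, hξh, Function.comp_apply, Matrix.cons_val, smul_eq_mul]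
  ring

variable (p : MvPolynomial (Fin 2) ℝ) (q : MvPolynomial (Fin 3) ℂ)

theorem exists_norm_normalFormRemainder_sub_le (A : Type*) [NormedCommRing A] [NormedAlgebra ℂ A]
    [NormOneClass A] :
    ∃ C : ℝ, 0 ≤ C ∧ ∀ (ε : ℝ) (ξ : Fin 2 → ℂ), |ε| ≤ 1 → ‖ξ‖ ≤ 1 →
      ∀ h h' : Fin 2 → A, ‖h‖ ≤ 1 → ‖h'‖ ≤ 1 →
        ‖normalFormRemainder p q ξ ε h - normalFormRemainder p q ξ ε h'‖ ≤
          C * (‖h‖ + ‖h'‖) * ‖h - h'‖ := by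
  obtain ⟨C, hC, hp⟩ := exists_norm_taylorRemainder_sub_le A p zero_le_one
  obtain ⟨D, hD, hq⟩ := exists_norm_taylorRemainder_sub_le A q zero_le_one
  refine ⟨C + D, add_nonneg hC hD, fun ε ξ hε hξ h h' hh hh' => ?_⟩
  have hconst {σ : Type} [Fintype σ] {ζ : σ → ℂ} (hζ : ‖ζ‖ ≤ 1) : ‖algebraMap ℂ A ∘ ζ‖ ≤ 1 :=
    (pi_norm_le_iff_of_nonneg zero_le_one).mpr fun i =>
      (norm_algebraMap' A (ζ i)).trans_le ((norm_le_pi_norm ζ i).trans hζ)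
  have hext (k : Fin 2 → A) : ‖![k 0, k 1, 0]‖ ≤ ‖k‖ :=
    (pi_norm_le_iff_of_nonneg (norm_nonneg k)).mpr <| by
      simp [Fin.forall_fin_succ, norm_le_pi_norm k]
  have hsub : ![h 0, h 1, 0] - ![h' 0, h' 1, 0] = ![(h - h') 0, (h - h') 1, 0] := by
    funext i
    fin_cases i
    exacts [rfl, rfl, sub_zero 0]
  have hξε : ‖![ξ 0, ξ 1, (ε : ℂ)]‖ ≤ 1 := (pi_norm_le_iff_of_nonneg zero_le_one).mpr <| by
    simp [Fin.forall_fin_succ, hε, (norm_le_pi_norm ξ _).trans hξ]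
  have hIε : ‖I * (ε : ℂ)‖ ≤ 1 := by
    rwa [norm_mul, norm_I, one_mul, norm_real]
  have hq' := hq _ _ _ (hconst hξε) ((hext h).trans hh) ((hext h').trans hh')
  rw [hsub] at hq'
  rw [normalFormRemainder, normalFormRemainder, add_sub_add_comm, ← smul_sub]
  calc _ ≤ C * (‖h‖ + ‖h'‖) * ‖h - h'‖ + 1 * (D * (‖h‖ + ‖h'‖) * ‖h - h'‖) := by
        refine norm_add_le_of_le (hp _ _ _ (hconst hξ) hh hh') ?_
        rw [norm_smul]
        gcongr
        refine hq'.trans ?_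
        gcongr
        exacts [hext h, hext h', hext (h - h')]
    _ = (C + D) * (‖h‖ + ‖h'‖) * ‖h - h'‖ := by ring

end NormalForm

/-! ### Uniform nondegeneracy near the zero section -/

section Nondegeneracy

theorem det_ne_zero_of_linearIndependent {u v : Fin 2 → ℝ} (h : LinearIndependent ℝ ![u, v]) :
    u 0 * v 1 - u 1 * v 0 ≠ 0 := by
  have hunit := Matrix.linearIndependent_rows_iff_isUnit.mp
    (show LinearIndependent ℝ (Matrix.of ![u, v]).row from h)
  have hdet := ((Matrix.isUnit_iff_isUnit_det _).mp hunit).ne_zero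
  rwa [Matrix.det_fin_two] at hdet

variable (p : MvPolynomial (Fin 2) ℝ) (q : MvPolynomial (Fin 3) ℂ)

theorem gradP_ofReal (ξ : Fin 2 → ℝ) (i : Fin 2) :
    gradP p (fun i => (ξ i : ℂ)) i = (MvPolynomial.eval ξ (MvPolynomial.pderiv i p) : ℝ) := by
  rw [gradP, ← MvPolynomial.coe_aeval_eq_eval]
  exact MvPolynomial.aeval_algebraMap_apply ℂ ξ _

theorem continuous_gradP_ofReal :
    Continuous fun ξ : Fin 2 → ℝ => gradP p (fun i => (ξ i : ℂ)) :=
  continuous_pi fun i => by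
    simp only [gradP_ofReal]
    exact continuous_ofReal.comp (MvPolynomial.continuous_eval _)

theorem continuous_gradQ_ofReal :
    Continuous fun z : (Fin 2 → ℝ) × ℝ => gradQ q (fun i => (z.1 i : ℂ)) z.2 :=
  continuous_pi fun i =>
    (MvPolynomial.continuous_eval (MvPolynomial.pderiv i.castSucc q)).comp
      (continuous_pi fun j => by
        fin_cases j
        exacts [continuous_ofReal.comp ((continuous_apply 0).comp continuous_fst),
          continuous_ofReal.comp ((continuous_apply 1).comp continuous_fst),
          continuous_ofReal.comp continuous_snd])

theorem exists_isNondegeneratePair {Z : Type*} [TopologicalSpace Z] {F G : Z → Fin 2 → ℂ} {z₀ : Z}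
    (hF : ContinuousAt F z₀) (hG : ContinuousAt G z₀) (hFim : ∀ z i, (F z i).im = 0)
    (hdet : (F z₀ 0).re * (G z₀ 1).re - (F z₀ 1).re * (G z₀ 0).re ≠ 0) :
    ∃ c > 0, ∃ Λ > 0, ∀ᶠ z in nhds z₀, IsNondegeneratePair c Λ (F z) (G z) := by
  have hre {H : Z → Fin 2 → ℂ} (hH : ContinuousAt H z₀) (i : Fin 2) :
      ContinuousAt (fun z => (H z i).re) z₀ :=
    continuous_re.continuousAt.comp (continuousAt_pi.mp hH i)
  have hdetc : ContinuousAt (fun z => |(F z 0).re * (G z 1).re - (F z 1).re * (G z 0).re|) z₀ :=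
    (((hre hF 0).mul (hre hG 1)).sub ((hre hF 1).mul (hre hG 0))).abs
  have hpos := abs_pos.mpr hdet
  refine ⟨_, half_pos hpos, ‖F z₀‖ + ‖G z₀‖ + 1, by positivity, ?_⟩
  filter_upwards [hdetc.eventually_const_lt (half_lt_self hpos),
    hF.norm.eventually_lt_const (lt_add_one _), hG.norm.eventually_lt_const (lt_add_one _)]
    with z hz hFz hGz
  refine ⟨hFim z, fun i => ?_, fun i => ?_, hz.le⟩
  · linarith [norm_le_pi_norm (F z) i, norm_nonneg (G z₀)]
  · linarith [norm_le_pi_norm (G z) i, norm_nonneg (F z₀)]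

variable {p q}

theorem exists_uniform_transport_inverse
    (hpq : LinearIndependent ℝ
      ![fun i : Fin 2 => (gradP p 0 i).re, fun i : Fin 2 => (gradQ q 0 0 i).re])
    {a : NNReal} (ha : 0 < a) :
    ∃ τ ≥ 0, ∃ ε₁ > 0, ε₁ ≤ 1 ∧ ∀ (ξ : Fin 2 → ℝ) (ε : ℝ), ‖ξ‖ < ε₁ → 0 < ε → ε < ε₁ →
      ∃ y, IsDualPair ![gradP p (fun i => (ξ i : ℂ)), gradQ q (fun i => (ξ i : ℂ)) ε] y ∧
        ∃ T : Wiener (Fin 2) a →L[ℂ] (Fin 2 → Wiener (Fin 2) a), ‖T‖ ≤ τ / ε ∧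
          IsTransportInverse (gradP p (fun i => (ξ i : ℂ))) (gradQ q (fun i => (ξ i : ℂ)) ε) ε y
            T := by
  have hzero : (fun i => (((0 : (Fin 2 → ℝ) × ℝ).1 i : ℝ) : ℂ)) = 0 := funext fun _ => ofReal_zero
  obtain ⟨c, hc, Λ, hΛ, hpair⟩ := exists_isNondegeneratePair (z₀ := (0 : (Fin 2 → ℝ) × ℝ))
    ((continuous_gradP_ofReal p).comp continuous_fst).continuousAt
    (continuous_gradQ_ofReal q).continuousAt
    (fun z i => by rw [Function.comp_apply, gradP_ofReal, ofReal_im])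
    (by rw [Function.comp_apply, hzero]; exact det_ne_zero_of_linearIndependent hpq)
  obtain ⟨ε₁, hε₁, hball⟩ := Metric.eventually_nhds_iff.mp hpair
  refine ⟨8 * Λ / c, by positivity, min ε₁ (min 1 (c / (4 * Λ ^ 2))), by positivity,
    (min_le_right _ _).trans (min_le_left _ _), fun ξ ε hξ hε hε₁ => ?_⟩
  obtain ⟨hξ₁, -⟩ := lt_min_iff.mp hξ
  obtain ⟨hε₁, hε1, hεΛ⟩ : _ ∧ _ ∧ _ := by simpa only [lt_min_iff] using hε₁
  refine (hball (y := (ξ, ε)) ?_).exists_transport_inverse ha hc hε hε1.le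
    ((lt_div_iff₀ (by positivity)).mp hεΛ).le
  rw [dist_zero_right, Prod.norm_def, Real.norm_of_nonneg hε.le]
  exact max_lt hξ₁ hε₁

end Nondegeneracy

/-! ### The contraction argument -/

section Contraction

variable {X Y : Type*} [NormedAddCommGroup X] [NormedAddCommGroup Y]

theorem exists_fixedPoint_of_half_lipschitz [CompleteSpace X] {Ψ : X → X} {R : ℝ} (hR : 0 ≤ R)
    (h0 : ‖Ψ 0‖ ≤ R / 2)
    (hΨ : ∀ v v', ‖v‖ ≤ R → ‖v'‖ ≤ R → ‖Ψ v - Ψ v'‖ ≤ 1 / 2 * ‖v - v'‖) :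
    ∃ v, ‖v‖ ≤ R ∧ Ψ v = v := by
  have hmaps : Set.MapsTo Ψ (Metric.closedBall 0 R) (Metric.closedBall 0 R) := fun v hv => by
    rw [mem_closedBall_zero_iff] at hv ⊢
    have hlip := hΨ v 0 hv (norm_zero.trans_le hR)
    rw [sub_zero] at hlip
    linarith [norm_le_norm_sub_add (Ψ v) (Ψ 0)]
  have hcontr : ContractingWith (1 / 2) (hmaps.restrict Ψ _ _) := by
    refine ⟨by rw [← NNReal.coe_lt_coe]; norm_num, LipschitzWith.of_dist_le_mul fun v v' => ?_⟩
    have hlip := hΨ v v' (mem_closedBall_zero_iff.mp v.2) (mem_closedBall_zero_iff.mp v'.2)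
    simpa [Subtype.dist_eq, dist_eq_norm] using hlip
  obtain ⟨v, hv, hfix, -⟩ := hcontr.exists_fixedPoint' Metric.isClosed_closedBall.isComplete
    hmaps (Metric.mem_closedBall_self hR) (edist_ne_top _ _)
  exact ⟨v, mem_closedBall_zero_iff.mp hv, hfix⟩

variable [NormedSpace ℂ X] [NormedSpace ℂ Y]

/-- The right hand side of the equation for a gradient `v` after division by `e`: `Q` collects the
quadratic terms of the symbol, evaluated at `e v`, and `Φ` the perturbation. -/
def rescaledForcing (Q Φ : X → Y) (e : ℝ) (v : X) : Y := -((e : ℂ)⁻¹ • (Q ((e : ℂ) • v) + Φ v))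

variable {Q Φ : X → Y} {b C e R : ℝ}

theorem norm_rescaledForcing_zero_le (he : 0 ≤ e) (hQ₀ : Q 0 = 0) (hΦ₀ : ‖Φ 0‖ ≤ b) :
    ‖rescaledForcing Q Φ e 0‖ ≤ b / e := by
  rw [rescaledForcing, smul_zero, hQ₀, zero_add, norm_neg, norm_smul, norm_inv, norm_real,
    Real.norm_of_nonneg he, inv_mul_eq_div]
  gcongr

theorem norm_rescaledForcing_sub_le (he : 0 < e) (he1 : e ≤ 1) (hR : R ≤ 1) (hC : 0 ≤ C)
    (hQ : ∀ h h', ‖h‖ ≤ 1 → ‖h'‖ ≤ 1 → ‖Q h - Q h'‖ ≤ C * (‖h‖ + ‖h'‖) * ‖h - h'‖)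
    (hΦ : ∀ v v', ‖v‖ ≤ R → ‖v'‖ ≤ R → ‖Φ v - Φ v'‖ ≤ b * ‖v - v'‖)
    {v v' : X} (hv : ‖v‖ ≤ R) (hv' : ‖v'‖ ≤ R) :
    ‖rescaledForcing Q Φ e v - rescaledForcing Q Φ e v'‖ ≤ (2 * C * e * R + b / e) * ‖v - v'‖ := by
  have hnorm (w : X) : ‖(e : ℂ) • w‖ = e * ‖w‖ := by
    rw [norm_smul, norm_real, Real.norm_of_nonneg he.le]
  have hball {w : X} (hw : ‖w‖ ≤ R) : ‖(e : ℂ) • w‖ ≤ 1 := by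
    rw [hnorm]
    exact mul_le_one₀ he1 (norm_nonneg w) (hw.trans hR)
  have hdiff : rescaledForcing Q Φ e v - rescaledForcing Q Φ e v' =
      -((e : ℂ)⁻¹ • ((Q ((e : ℂ) • v) - Q ((e : ℂ) • v')) + (Φ v - Φ v'))) := by
    simp only [rescaledForcing]
    module
  have hQ' : ‖Q ((e : ℂ) • v) - Q ((e : ℂ) • v')‖ ≤ C * (e * R + e * R) * (e * ‖v - v'‖) := by
    refine (hQ _ _ (hball hv) (hball hv')).trans ?_
    rw [← smul_sub, hnorm, hnorm, hnorm]
    gcongr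
  calc ‖rescaledForcing Q Φ e v - rescaledForcing Q Φ e v'‖
    _ ≤ e⁻¹ * (C * (e * R + e * R) * (e * ‖v - v'‖) + b * ‖v - v'‖) := by
      rw [hdiff, norm_neg, norm_smul, norm_inv, norm_real, Real.norm_of_nonneg he.le]
      gcongr
      exact norm_add_le_of_le hQ' (hΦ v v' hv hv')
    _ = (2 * C * e * R + b / e) * ‖v - v'‖ := by
      field_simp
      ring

theorem exists_rescaledForcing_fixedPoint [CompleteSpace X] {T : Y →L[ℂ] X} {A : ℝ} (he : 0 < e)
    (he1 : e ≤ 1) (hR : R ≤ 1) (hC : 0 ≤ C) (hT : ‖T‖ ≤ A) (hQ₀ : Q 0 = 0)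
    (hQ : ∀ h h', ‖h‖ ≤ 1 → ‖h'‖ ≤ 1 → ‖Q h - Q h'‖ ≤ C * (‖h‖ + ‖h'‖) * ‖h - h'‖)
    (hΦ₀ : ‖Φ 0‖ ≤ b) (hΦ : ∀ v v', ‖v‖ ≤ R → ‖v'‖ ≤ R → ‖Φ v - Φ v'‖ ≤ b * ‖v - v'‖)
    (hbR : A * (b / e) ≤ R / 2) (hlip : A * (2 * C * e * R + b / e) ≤ 1 / 2) :
    ∃ v, ‖v‖ ≤ R ∧ T (rescaledForcing Q Φ e v) = v := by
  have hA : 0 ≤ A := (norm_nonneg T).trans hT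
  have hb : 0 ≤ b := (norm_nonneg _).trans hΦ₀
  have hR0 : 0 ≤ R := by linarith [show 0 ≤ A * (b / e) by positivity]
  refine exists_fixedPoint_of_half_lipschitz hR0 ?_ fun v v' hv hv' => ?_
  · refine (T.le_of_opNorm_le hT _).trans (le_trans ?_ hbR)
    gcongr
    exact norm_rescaledForcing_zero_le he.le hQ₀ hΦ₀
  · rw [← map_sub]
    refine (T.le_of_opNorm_le hT _).trans ?_
    calc _ ≤ A * ((2 * C * e * R + b / e) * ‖v - v'‖) := by
          gcongr
          exact norm_rescaledForcing_sub_le he he1 hR hC hQ hΦ hv hv'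
      _ ≤ 1 / 2 * ‖v - v'‖ := by
          rw [← mul_assoc]
          gcongr

end Contraction

/-! ### Solution of the Hamilton–Jacobi equation -/

section Solution

theorem grad_phase {ρ : (Fin 2 → ℝ) → ℂ} {x : Fin 2 → ℝ} (hρ : DifferentiableAt ℝ ρ x)
    (ξ : Fin 2 → ℝ) (e : ℝ) : grad (phase ξ e ρ) x = (fun i => (ξ i : ℂ)) + (e : ℂ) • grad ρ x := by
  let ℓ : (Fin 2 → ℝ) →L[ℝ] ℂ := ofRealCLM ∘L ∑ i, ξ i • ContinuousLinearMap.proj i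
  have hℓ (x : Fin 2 → ℝ) : ℓ x = ((∑ i, x i * ξ i : ℝ) : ℂ) := by simp [ℓ, mul_comm]
  have hphase : phase ξ e ρ = ℓ + fun x => (e : ℂ) * ρ x := by
    funext x
    simp only [phase, Pi.add_apply, hℓ]
  have hderiv : HasFDerivAt (phase ξ e ρ) (ℓ + (e : ℂ) • fderiv ℝ ρ x) x :=
    hphase ▸ ℓ.hasFDerivAt.add (hρ.hasFDerivAt.const_mul (e : ℂ))
  funext i
  have hℓi : ℓ (Pi.single i 1) = ξ i := by simp [hℓ, Pi.single_apply]
  rw [grad, hderiv.fderiv, _root_.add_apply, hℓi]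
  rfl

theorem norm_ofReal_comp {ι : Type*} [Fintype ι] (ξ : ι → ℝ) : ‖fun i => (ξ i : ℂ)‖ = ‖ξ‖ := by
  simp only [Pi.norm_def, nnnorm_real]

variable {κ K : ℝ} {M N : ℕ} {r : (Fin 2 → ℂ) → (Fin 2 → ℂ) → ℝ → ℂ} {a : NNReal}
  {ε e C₀ τ C L μ : ℝ} {ξ : Fin 2 → ℂ}

theorem contraction_bounds (hε : 0 < ε) (he : 0 < e) (hτ : 0 ≤ τ) (hC : 0 ≤ C) (hL : 0 ≤ L)
    (hμ : 0 ≤ μ) (hsmall : (4 * τ ^ 2 * C * L + τ * L) * (μ / (ε * min ε e)) ≤ 1 / 4) :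
    2 * τ * L * (μ / (ε * e)) ≤ 1 / 2 ∧
      τ / ε * (L * μ / e) ≤ 2 * τ * L * (μ / (ε * e)) / 2 ∧
      τ / ε * (2 * C * e * (2 * τ * L * (μ / (ε * e))) + L * μ / e) ≤ 1 / 2 := by
  have : 0 < min ε e := lt_min hε he
  have hη : μ / (ε * e) ≤ μ / (ε * min ε e) := by
    gcongr
    exact min_le_right _ _
  have hη' : μ / (ε * ε) ≤ μ / (ε * min ε e) := by
    gcongr
    exact min_le_left _ _
  have hlin : τ * L * (μ / (ε * e)) ≤ τ * L * (μ / (ε * min ε e)) := by gcongr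
  have hquad : 4 * τ ^ 2 * C * L * (μ / (ε * ε)) ≤ 4 * τ ^ 2 * C * L * (μ / (ε * min ε e)) := by
    gcongr
  have hquad0 : 0 ≤ 4 * τ ^ 2 * C * L * (μ / (ε * ε)) := by positivity
  have hΦ : τ / ε * (L * μ / e) = τ * L * (μ / (ε * e)) := by field_simp
  have hQ : τ / ε * (2 * C * e * (2 * τ * L * (μ / (ε * e)))) =
      4 * τ ^ 2 * C * L * (μ / (ε * ε)) := by
    field_simp
    ring
  refine ⟨?_, ?_, ?_⟩
  · linarith
  · linarith
  · rw [mul_add, hQ, hΦ]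
    linarith

variable {p : MvPolynomial (Fin 2) ℝ} {q : MvPolynomial (Fin 3) ℂ}

/-- The right hand side `f` of the transport equation `(p'_ξ + iε q'_ξ) · v = f` that the gradient
`v` of `ρ` has to satisfy for `x · ξ + e ρ(x)` to solve the Hamilton–Jacobi equation. -/
def gradientForcing (p : MvPolynomial (Fin 2) ℝ) (q : MvPolynomial (Fin 3) ℂ)
    (r : (Fin 2 → ℂ) → (Fin 2 → ℂ) → ℝ → ℂ) (ξ : Fin 2 → ℂ) (ε e : ℝ) :
    (Fin 2 → Wiener (Fin 2) a) → Wiener (Fin 2) a :=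
  rescaledForcing (normalFormRemainder p q ξ ε) (composition a (fun x ζ => r x ζ ε) ξ e) e

/-- The constant in the bound of the remainder on the Wiener algebra by `ε^M + e^N`, for `|ξ|` at
most `C₀ e`. -/
def remainderConst (a : NNReal) (K C₀ : ℝ) (N : ℕ) : ℝ :=
  16 * (decaySum a * (|K| * (C₀ + 1) ^ N))

theorem remainderConst_nonneg (a : NNReal) (K : ℝ) (hC₀ : 0 ≤ C₀) (N : ℕ) :
    0 ≤ remainderConst a K C₀ N :=
  mul_nonneg (by norm_num) (mul_nonneg (decaySum_nonneg a) (by positivity))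

namespace IsRemainder

variable (hr : IsRemainder κ K M N r)
include hr

theorem isPeriodicSymbol (hε : ε ∈ Set.Ioo 0 κ) : IsPeriodicSymbol κ fun x ζ => r x ζ ε :=
  ⟨hr.holomorphic ε hε, hr.periodic ε hε⟩

theorem norm_le (hε : ε ∈ Set.Ioo 0 κ) (hC₀ : 0 ≤ C₀) {x ζ : Fin 2 → ℂ}
    (hxζ : (x, ζ) ∈ complexNhd κ) (hζ : ‖ζ‖ ≤ (C₀ + 1) * e) :
    ‖r x ζ ε‖ ≤ |K| * (C₀ + 1) ^ N * (ε ^ M + e ^ N) := by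
  have hε0 := hε.1.le
  calc ‖r x ζ ε‖
    _ ≤ K * (ε ^ M + ‖ζ‖ ^ N) := hr.bound ε hε x ζ hxζ
    _ ≤ |K| * ((C₀ + 1) ^ N * ε ^ M + ((C₀ + 1) * e) ^ N) := by
      gcongr
      · exact le_abs_self K
      · exact le_mul_of_one_le_left (by positivity) (one_le_pow₀ (by linarith))
    _ = |K| * (C₀ + 1) ^ N * (ε ^ M + e ^ N) := by
      rw [mul_pow]
      ring

variable (ha : 0 < a) (haκ : 2 * (a : ℝ) < κ) (hε : ε ∈ Set.Ioo 0 κ) (hC₀ : 0 ≤ C₀) (he : 0 < e)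
  (heκ : (C₀ + 1) * e < κ) (hξ : ‖ξ‖ ≤ C₀ * e)
include ha haκ hε hC₀ he heκ hξ

theorem norm_composition_le {v : Fin 2 → Wiener (Fin 2) a} (hv : ‖v‖ ≤ 1 / 2) :
    ‖composition a (fun x ζ => r x ζ ε) ξ e v‖ ≤
      remainderConst a K C₀ N * (ε ^ M + e ^ N) := by
  have hbound := (hr.isPeriodicSymbol hε).norm_composition_le ha haκ he.le (by linarith)
    (fun x ζ hxζ hζ => hr.norm_le (e := e) hε hC₀ hxζ (by linarith)) hv
  have hS := decaySum_nonneg a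
  have hε0 := hε.1.le
  refine hbound.trans ?_
  rw [remainderConst]
  have : 0 ≤ decaySum a * (|K| * (C₀ + 1) ^ N * (ε ^ M + e ^ N)) := by positivity
  linarith

theorem norm_composition_sub_le {v v' : Fin 2 → Wiener (Fin 2) a} (hv : ‖v‖ ≤ 1 / 2)
    (hv' : ‖v'‖ ≤ 1 / 2) :
    ‖composition a (fun x ζ => r x ζ ε) ξ e v - composition a (fun x ζ => r x ζ ε) ξ e v'‖ ≤
      remainderConst a K C₀ N * (ε ^ M + e ^ N) * ‖v - v'‖ := by
  refine ((hr.isPeriodicSymbol hε).norm_composition_sub_le ha haκ he.le (by linarith)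
    (fun x ζ hxζ hζ => hr.norm_le (e := e) hε hC₀ hxζ (by linarith)) hv hv').trans_eq ?_
  rw [remainderConst]
  ring

theorem eval_composition {v : Fin 2 → Wiener (Fin 2) a} (hv : ‖v‖ ≤ 1 / 2) (x : Fin 2 → ℝ) :
    Wiener.eval x (composition a (fun x ζ => r x ζ ε) ξ e v) =
      r (fun i => x i) (ξ + (e : ℂ) • fun i => Wiener.eval x (v i)) ε :=
  (hr.isPeriodicSymbol hε).eval_composition ha haκ he.le (by linarith)
    (fun x ζ hxζ hζ => hr.norm_le (e := e) hε hC₀ hxζ (by linarith)) hv x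

theorem exists_gradient (he1 : e ≤ 1) (hC : 0 ≤ C)
    (hQ : ∀ h h' : Fin 2 → Wiener (Fin 2) a, ‖h‖ ≤ 1 → ‖h'‖ ≤ 1 →
      ‖normalFormRemainder p q ξ ε h - normalFormRemainder p q ξ ε h'‖ ≤
        C * (‖h‖ + ‖h'‖) * ‖h - h'‖)
    {T : Wiener (Fin 2) a →L[ℂ] (Fin 2 → Wiener (Fin 2) a)} (hτ : 0 ≤ τ) (hT : ‖T‖ ≤ τ / ε)
    (hsmall : (4 * τ ^ 2 * C * remainderConst a K C₀ N + τ * remainderConst a K C₀ N) *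
      ((ε ^ M + e ^ N) / (ε * min ε e)) ≤ 1 / 4) :
    ∃ v, ‖v‖ ≤ 1 / 2 ∧
      ‖v‖ ≤ 2 * τ * remainderConst a K C₀ N * ((ε ^ M + e ^ N) / (ε * e)) ∧
      T (gradientForcing p q r ξ ε e v) = v := by
  have hε0 := hε.1
  obtain ⟨hR, hbR, hlip⟩ := contraction_bounds hε0 he hτ hC
    (remainderConst_nonneg a K hC₀ N) (by positivity) hsmall
  obtain ⟨v, hv, hfix⟩ := exists_rescaledForcing_fixedPoint he he1 (hR.trans (by norm_num)) hC hT
    (normalFormRemainder_zero p q ξ ε) hQ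
    (hr.norm_composition_le ha haκ hε hC₀ he heκ hξ (by simp))
    (fun v v' hv hv' => hr.norm_composition_sub_le ha haκ hε hC₀ he heκ hξ (hv.trans hR)
      (hv'.trans hR)) hbR hlip
  exact ⟨v, hv.trans hR, hv, hfix⟩

theorem symbol_eq_normalForm {v : Fin 2 → Wiener (Fin 2) a} (hv : ‖v‖ ≤ 1 / 2)
    (htransport : ∑ j, complexCovector (gradP p ξ) (gradQ q ξ ε) ε j • v j =
      gradientForcing p q r ξ ε e v)
    (x : Fin 2 → ℝ) :
    symbol p q r (fun i => x i) (ξ + (e : ℂ) • fun i => Wiener.eval x (v i)) ε =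
      normalForm p q ξ ε := by
  have heval := congrArg (fun f => (e : ℂ) * Wiener.eval x f) htransport
  have hshift : (fun i => ξ i + (e : ℂ) * Wiener.eval x (v i)) =
    ξ + (e : ℂ) • fun i => Wiener.eval x (v i) := rfl
  simp only [gradientForcing, rescaledForcing, map_smul, map_neg, map_add, map_normalFormRemainder,
    hr.eval_composition ha haκ hε hC₀ he heκ hξ hv x, Pi.smul_apply, smul_eq_mul, hshift,
    mul_neg, mul_inv_cancel_left₀ (ofReal_ne_zero.mpr he.ne'), Fin.sum_univ_two] at heval
  rw [symbol]
  linear_combination heval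

end IsRemainder

theorem IsRemainder.exists_solution (hr : IsRemainder κ K M N r) (ha : 0 < a)
    (haκ : 2 * (a : ℝ) < κ) (hε : ε ∈ Set.Ioo 0 κ) (hC₀ : 0 ≤ C₀) (he : 0 < e) (he1 : e ≤ 1)
    (heκ : (C₀ + 1) * e < κ) {ξ : Fin 2 → ℝ} (hξ : ‖ξ‖ ≤ C₀ * e)
    (hC : 0 ≤ C)
    (hQ : ∀ h h' : Fin 2 → Wiener (Fin 2) a, ‖h‖ ≤ 1 → ‖h'‖ ≤ 1 →
      ‖normalFormRemainder p q (fun i => (ξ i : ℂ)) ε h -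
        normalFormRemainder p q (fun i => (ξ i : ℂ)) ε h'‖ ≤ C * (‖h‖ + ‖h'‖) * ‖h - h'‖)
    {y : Fin 2 → ((Fin 2 → ℝ) →ₗ[ℝ] ℂ)}
    {T : Wiener (Fin 2) a →L[ℂ] (Fin 2 → Wiener (Fin 2) a)} (hτ : 0 ≤ τ) (hT : ‖T‖ ≤ τ / ε)
    (hTinv : IsTransportInverse (gradP p (fun i => (ξ i : ℂ))) (gradQ q (fun i => (ξ i : ℂ)) ε) ε
      y T)
    (hsmall : (4 * τ ^ 2 * C * remainderConst a K C₀ N + τ * remainderConst a K C₀ N) *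
      ((ε ^ M + e ^ N) / (ε * min ε e)) ≤ 1 / 4) :
    ∃ (ρper : (Fin 2 → ℝ) → ℂ) (b : ℂ) (v : Fin 2 → Wiener (Fin 2) a),
      ContDiff ℝ ∞ ρper ∧ TorusPeriodic ρper ∧
      grad (fun x => ρper x + b * wStar ε y x) = (fun x j => Wiener.eval x (v j)) ∧
      SolvesHJ κ (symbol p q r) ε (normalForm p q (fun i => (ξ i : ℂ)) ε)
        (phase ξ e fun x => ρper x + b * wStar ε y x) ∧
      ‖v‖ ≤ 2 * τ * remainderConst a K C₀ N * ((ε ^ M + e ^ N) / (ε * e)) := by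
  have hξc : ‖fun i => (ξ i : ℂ)‖ ≤ C₀ * e := (norm_ofReal_comp ξ).trans_le hξ
  obtain ⟨v, hv, hvη, hfix⟩ := hr.exists_gradient ha haκ hε hC₀ he heκ hξc he1 hC hQ hτ hT
    hsmall
  obtain ⟨ρper, b, hρ, hρper, hgrad⟩ := hTinv.exists_potential
    (gradientForcing p q r (fun i => (ξ i : ℂ)) ε e v)
  have htransport := hTinv.sum_smul
    (gradientForcing p q r (fun i => (ξ i : ℂ)) ε e v)
  rw [hfix] at hgrad htransport
  refine ⟨ρper, b, v, hρ, hρper, hgrad, fun x => ?_, hvη⟩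
  have heval : ‖fun i => Wiener.eval x (v i)‖ ≤ 1 :=
    (pi_norm_le_iff_of_nonneg zero_le_one).mpr fun i =>
      (AlgHom.norm_apply_le_self _ (v i)).trans ((norm_le_pi_norm v i).trans (by linarith))
  rw [grad_phase ((hρ.add (contDiff_const.mul (contDiff_wStar ε y))).differentiable (by simp) x),
    hgrad]
  exact ⟨ofReal_mem_complexNhd x ((norm_add_smul_le _ he.le heval).trans_lt (by linarith)),
    hr.symbol_eq_normalForm ha haκ hε hC₀ he heκ hξc hv htransport x⟩

end Solution

end

end HamiltonJacobi

open HamiltonJacobi in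
theorem proposition4p1_general
    (M N : ℕ) (p : MvPolynomial (Fin 2) ℝ) (q : MvPolynomial (Fin 3) ℂ)
    (hpq : LinearIndependent ℝ
      ![fun i : Fin 2 => (gradP p 0 i).re,
        fun i : Fin 2 => (gradQ q 0 0 i).re])
    (r : (Fin 2 → ℂ) → (Fin 2 → ℂ) → ℝ → ℂ) (κ K : ℝ) (hκ : 0 < κ)
    (hr : IsRemainder κ K M N r)
    (C₀ : ℝ) (hC₀ : 0 < C₀) :
    ∃ ε₀ > (0 : ℝ), ∃ δ > (0 : ℝ), ∃ C : ℝ → ℝ,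
      ∀ ε e : ℝ, 0 < ε → ε < ε₀ → 0 < e → e < ε₀ →
        (ε ^ M + e ^ N) / (ε * min ε e) ≤ δ →
        ∀ ξ : Fin 2 → ℝ, ‖ξ‖ ≤ C₀ * e →
          ∃ (y : Fin 2 → ((Fin 2 → ℝ) →ₗ[ℝ] ℂ)) (ρper : (Fin 2 → ℝ) → ℂ) (b : ℂ)
            (ρ : (Fin 2 → ℝ) → ℂ),
            IsDualPair
              ![gradP p (fun i => (ξ i : ℂ)),
                gradQ q (fun i => (ξ i : ℂ)) ε] y ∧
            ContDiff ℝ ∞ ρper ∧ TorusPeriodic ρper ∧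
            (∀ x, ρ x = ρper x + b * wStar ε y x) ∧
            GradPeriodic ρ ∧
            SolvesHJ κ (symbol p q r) ε
              (normalForm p q (fun i => (ξ i : ℂ)) ε)
              (phase ξ e ρ) ∧
            ∀ s : ℝ,
              sobolevNorm s (grad ρ) ≤
                ENNReal.ofReal (C s * ((ε ^ M + e ^ N) / (ε * e))) := by
  obtain ⟨a, ha, haκ⟩ : ∃ a : NNReal, 0 < a ∧ 2 * (a : ℝ) < κ :=
    ⟨⟨κ / 4, by positivity⟩, NNReal.coe_pos.mp (by positivity : 0 < κ / 4),
      (by linarith : 2 * (κ / 4) < κ)⟩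
  obtain ⟨τ, hτ, ε₁, hε₁, hε₁1, htransport⟩ := exists_uniform_transport_inverse hpq ha
  obtain ⟨C, hC, hQ⟩ := exists_norm_normalFormRemainder_sub_le p q (Wiener (Fin 2) a)
  choose D hD0 hD using Wiener.exists_sobolevNorm_le ha
  have hL := remainderConst_nonneg a K hC₀.le N
  obtain ⟨δ, hδ, hsmall⟩ := exists_pos_mul_lt (by norm_num : (0 : ℝ) < 1 / 4)
    (4 * τ ^ 2 * C * remainderConst a K C₀ N + τ * remainderConst a K C₀ N)
  refine ⟨min ε₁ κ / (C₀ + 1), by positivity, δ, hδ,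
    fun s => D s * (2 * τ * remainderConst a K C₀ N), fun ε e hε hε₀ he he₀ hεe ξ hξ => ?_⟩
  obtain ⟨hεε₁, hεκ⟩ := lt_min_iff.mp ((lt_div_iff₀' (by positivity)).mp hε₀)
  obtain ⟨heε₁, heκ⟩ := lt_min_iff.mp ((lt_div_iff₀' (by positivity)).mp he₀)
  have hCε : 0 < C₀ * ε := by positivity
  have hCe : 0 < C₀ * e := by positivity
  obtain ⟨y, hy, T, hT, hTinv⟩ := htransport ξ ε (by linarith) hε (by linarith)
  obtain ⟨ρper, b, v, hρ, hρper, hgrad, hHJ, hv⟩ := hr.exists_solution ha haκ ⟨hε, by linarith⟩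
    hC₀.le he (by linarith) heκ hξ hC
    (hQ ε _ (abs_le.mpr ⟨by linarith, by linarith⟩) (by rw [norm_ofReal_comp]; linarith))
    hτ hT hTinv ((mul_le_mul_of_nonneg_left hεe (by positivity)).trans hsmall.le)
  refine ⟨y, ρper, b, _, hy, hρ, hρper, fun _ => rfl,
    ⟨hρ.add (contDiff_const.mul (contDiff_wStar ε y)), ?_⟩, hHJ, fun s => ?_⟩
  · rw [hgrad]
    exact fun k x => funext fun j => Wiener.torusPeriodic_eval (v j) k x
  · rw [hgrad, mul_assoc]
    exact (hD s v).trans (ENNReal.ofReal_le_ofReal (mul_le_mul_of_nonneg_left hv (hD0 s)))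

theorem proposition4p1
    (M N : ℕ) (hM : 2 ≤ M) (hMN : M ≤ N)
    (p : MvPolynomial (Fin 2) ℝ) (q : MvPolynomial (Fin 3) ℂ)
    (hpq : LinearIndependent ℝ
      ![fun i : Fin 2 => (HamiltonJacobi.gradP p 0 i).re,
        fun i : Fin 2 => (HamiltonJacobi.gradQ q 0 0 i).re])
    (r : (Fin 2 → ℂ) → (Fin 2 → ℂ) → ℝ → ℂ) (κ K : ℝ) (hκ : 0 < κ)
    (hr : HamiltonJacobi.IsRemainder κ K M N r)
    (C₀ : ℝ) (hC₀ : 0 < C₀) :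
    ∃ ε₀ > (0 : ℝ), ∃ δ > (0 : ℝ), ∃ C : ℝ → ℝ,
      ∀ ε e : ℝ, 0 < ε → ε < ε₀ → 0 < e → e < ε₀ →
        (ε ^ M + e ^ N) / (ε * min ε e) ≤ δ →
        ∀ ξ : Fin 2 → ℝ, ‖ξ‖ ≤ C₀ * e →
          ∃ (y : Fin 2 → ((Fin 2 → ℝ) →ₗ[ℝ] ℂ)) (ρper : (Fin 2 → ℝ) → ℂ) (b : ℂ)
            (ρ : (Fin 2 → ℝ) → ℂ),
            HamiltonJacobi.IsDualPair
              ![HamiltonJacobi.gradP p (fun i => (ξ i : ℂ)),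
                HamiltonJacobi.gradQ q (fun i => (ξ i : ℂ)) ε] y ∧
            ContDiff ℝ ∞ ρper ∧ HamiltonJacobi.TorusPeriodic ρper ∧
            (∀ x, ρ x = ρper x + b * HamiltonJacobi.wStar ε y x) ∧
            HamiltonJacobi.GradPeriodic ρ ∧
            HamiltonJacobi.SolvesHJ κ (HamiltonJacobi.symbol p q r) ε
              (HamiltonJacobi.normalForm p q (fun i => (ξ i : ℂ)) ε)
              (HamiltonJacobi.phase ξ e ρ) ∧
            ∀ s : ℝ, 1 < s →
              HamiltonJacobi.sobolevNorm s (HamiltonJacobi.grad ρ) ≤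
                ENNReal.ofReal (C s * ((ε ^ M + e ^ N) / (ε * e))) := by
  obtain ⟨ε₀, hε₀, δ, hδ, C, h⟩ := proposition4p1_general M N p q hpq r κ K hκ hr C₀ hC₀
  refine ⟨ε₀, hε₀, δ, hδ, C, fun ε e hε hεlt he helt hεe ξ hξ => ?_⟩
  obtain ⟨y, ρper, b, ρ, hy, hρper, hper, hρ, hgrad, hHJ, hs⟩ := h ε e hε hεlt he helt hεe ξ hξ
  exact ⟨y, ρper, b, ρ, hy, hρper, hper, hρ, hgrad, hHJ, fun s _ => hs s⟩
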